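/- Let $n\ge 1$. For real angles $\alpha_k$ $(1\le k\le n)$ and $\phi_{j,k},\psi_{j,k}$ $(1\le j<k\le n)$ define matrices recursively by $V_1=e^{i\alpha_1}$ and, for $m>1$, $$V_m=\begin{bmatrix}V_{m-1}&0\\0&1\end{bmatrix}H_m,\qquad H_m=\Phi_{1,m}\Phi_{2,m}\cdots\Phi_{m-1,m},$$ where $\Phi_{j,m}$ is the $m\times m$ matrix that agrees with the identity outside the rows and columns $j$ and $m$, and whose entries at the positions $(j,j),(j,m),(m,j),(m,m)$ are $$e^{ia}\cos\phi_{j,m},\quad e^{i\psi_{j,m}}\sin\phi_{j,m},\quad -e^{-i\psi_{j,m}}\sin\phi_{j,m},\quad e^{-ia}\cos\phi_{j,m},$$ with $a=\alpha_m$ if $j=1$ and $a=0$ if $j>1$. Call the angles admissible if $-\pi\le\alpha_k,\psi_{j,k}<\pi$ and $0\le\phi_{j,k}\le\pi/2$. 1. (Parametrisation.) $V_n$ is always unitary, every matrix in $\mathrm U(n)$ equals $V_n$ for some admissible angles, and admissible angles with all $\phi_{j,k}\in(0,\pi/2)$ are determined uniquely, among the angles of this kind, by $V_n$. 2. (LU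 decomposition.) Let the angles be admissible. (a) If $V_n=LU$ with $L$ lower triangular with unit diagonal and $U=(u_{j,k})$ upper triangular, then $$u_{1,1}=\exp\Big[i\sum_{j=1}^n\alpha_j\Big]\prod_{k=2}^n\cos\phi_{1,k},\qquad u_{l,l}=e^{-i\alpha_l}\,\frac{\prod_{k=l+1}^n\cos\phi_{l,k}}{\prod_{j=1}^{l-1}\cos\phi_{j,l}}\quad(2\le l\le n),$$ and for $1\le l\le n-1$ the product $u_{1,1}\cdots u_{l,l}$ equals $r_le^{i\varphi_l}$ with $$r_l=\prod_{j=1}^l\prod_{k=l+1}^n\cos\phi_{j,k}>0,\qquad e^{i\varphi_l}=\exp\Big[i\alpha_1+i\sum_{j=l+1}^n\alpha_j\Big].$$ (b) Whether or not such a decomposition exists, for $1\le l\le n-1$ the $l$-th leading principal minor of $V_n$ equals $r_le^{i\varphi_l}$, with $r_l\ge 0$ and $e^{i\varphi_l}$ given by the same formulas, and $\det V_n=e^{i\alpha_1}$. 3. (Haar measure.) There is exactly one left-invariant Haar probability measure on $\mathrm U(n)$, and in these coordinates it reads $$\Big(\prod_{1\le j<k\le n}2(k-j)(\cos\phi_{j,k})^{2(k-j)-1}\sin\phi_{j,k}\,d\phi_{j,k}\Big)\Big(\prod_{j=1}^n\frac{d\alpha_j}{2\pi}\Big)\Big(\prod_{1\le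 j<k\le n}\frac{d\psi_{j,k}}{2\pi}\Big),$$ that is, it is the image of this measure on the set of admissible angles under the map sending the angles to $V_n$. -/

import Mathlib

open MeasureTheory Matrix

noncomputable section

namespace HurwitzU

/-- One-based indices `1 ≤ j < k ≤ n` of the paper are stored zero-based: `k : Fin n` and
`j : Fin k`, so that the family `x` has exactly one entry `x k j` for each pair `j < k`. -/
abbrev PairAngles (n : ℕ) : Type := (k : Fin n) → Fin k → ℝ

/-- The matrix `diag(A, 1)`. -/
def diagOne {m : ℕ} (A : Matrix (Fin m) (Fin m) ℂ) : Matrix (Fin (m + 1)) (Fin (m + 1)) ℂ :=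
  Matrix.reindex finSumFinEquiv finSumFinEquiv
    (Matrix.fromBlocks A 0 0 (1 : Matrix (Fin 1) (Fin 1) ℂ))

/-- The matrix `Φ_{j,n}` with `n = m + 1` and `j` zero-based. It differs from the identity only
in the rows and columns `j` and `n`. The phases `e^{± iα}` on the diagonal are present only in
the first of these matrices. -/
def phiMat {m : ℕ} (α : ℝ) (φ ψ : Fin m → ℝ) (j : Fin m) :
    Matrix (Fin (m + 1)) (Fin (m + 1)) ℂ :=
  let a : ℝ := if j.val = 0 then α else 0
  Matrix.of fun r s =>
    if r = j.castSucc ∧ s = j.castSucc then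
      Complex.exp (Complex.I * (a : ℂ)) * (Real.cos (φ j) : ℂ)
    else if r = j.castSucc ∧ s = Fin.last m then
      Complex.exp (Complex.I * (ψ j : ℂ)) * (Real.sin (φ j) : ℂ)
    else if r = Fin.last m ∧ s = j.castSucc then
      -(Complex.exp (-(Complex.I * (ψ j : ℂ))) * (Real.sin (φ j) : ℂ))
    else if r = Fin.last m ∧ s = Fin.last m then
      Complex.exp (-(Complex.I * (a : ℂ))) * (Real.cos (φ j) : ℂ)
    else if r = s then 1 else 0

/-- The ordered product `H_n = Φ_{1,n} Φ_{2,n} ⋯ Φ_{n-1,n}` with `n = m + 1`. -/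
def prodH {m : ℕ} (α : ℝ) (φ ψ : Fin m → ℝ) : Matrix (Fin (m + 1)) (Fin (m + 1)) ℂ :=
  (List.ofFn (phiMat α φ ψ)).prod

/-- The iterative parametrisation: `V_1 = e^{iα_1}` and `V_n = diag(V_{n-1}, 1) H_n` for `n > 1`,
where `H_n` is built from the angles `α_n`, `φ_{j,n}`, `ψ_{j,n}` with `1 ≤ j < n`.
(For `n = 0` it is the empty matrix.) -/
def V : (n : ℕ) → (Fin n → ℝ) → PairAngles n → PairAngles n → Matrix (Fin n) (Fin n) ℂ
  | 0, _, _, _ => 1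
  | 1, α, _, _ => Matrix.of fun _ _ => Complex.exp (Complex.I * (α 0 : ℂ))
  | m + 2, α, φ, ψ =>
    diagOne (V (m + 1) (fun k => α k.castSucc) (fun k => φ k.castSucc) (fun k => ψ k.castSucc)) *
      prodH (m := m + 1) (α (Fin.last (m + 1))) (φ (Fin.last (m + 1))) (ψ (Fin.last (m + 1)))

/-- The ranges `-π ≤ α_k, ψ_{j,k} < π` and `0 ≤ φ_{j,k} ≤ π/2`. -/
structure InRange {n : ℕ} (α : Fin n → ℝ) (φ ψ : PairAngles n) : Prop where
  alpha : ∀ k, α k ∈ Set.Ico (-Real.pi) Real.pi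
  phi : ∀ k j, φ k j ∈ Set.Icc 0 (Real.pi / 2)
  psi : ∀ k j, ψ k j ∈ Set.Ico (-Real.pi) Real.pi

/-- `A = L U` is an LU decomposition: `L` is lower triangular with ones on the diagonal and
`U` is upper triangular. -/
structure IsLU {n : ℕ} (A L U : Matrix (Fin n) (Fin n) ℂ) : Prop where
  lower : ∀ i j, i < j → L i j = 0
  unit : ∀ i, L i i = 1
  upper : ∀ i j, j < i → U i j = 0
  eq : A = L * U

/-- The top left `l × l` block. -/
def leading {n : ℕ} (A : Matrix (Fin n) (Fin n) ℂ) (l : ℕ) (hl : l ≤ n) :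
    Matrix (Fin l) (Fin l) ℂ :=
  A.submatrix (Fin.castLE hl) (Fin.castLE hl)

/-- The claimed value of the diagonal entry `u_{l,l}` (with `l` zero-based):
`exp(i ∑_j α_j) ∏_{k > 1} cos φ_{1,k}` for the first one, and
`e^{-iα_l} ∏_{k > l} cos φ_{l,k} / ∏_{j < l} cos φ_{j,l}` for the others. -/
def uDiag {n : ℕ} (α : Fin n → ℝ) (φ : PairAngles n) (l : Fin n) : ℂ :=
  if l.val = 0 then
    Complex.exp (Complex.I * ((∑ j, α j : ℝ) : ℂ)) *
      ((∏ k : {k : Fin n // l < k}, Real.cos (φ k.1 ⟨l, k.2⟩) : ℝ) : ℂ)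
  else
    Complex.exp (-(Complex.I * (α l : ℂ))) *
      (((∏ k : {k : Fin n // l < k}, Real.cos (φ k.1 ⟨l, k.2⟩)) /
        (∏ j : Fin l, Real.cos (φ l j)) : ℝ) : ℂ)

/-- The radius `r_l = ∏_{j ≤ l} ∏_{k > l} cos φ_{j,k}` (`l` is a size, `j` and `k` are
one-based here; zero-based these are the `j < l` and the `k ≥ l`). -/
def radius {n : ℕ} (φ : PairAngles n) (l : ℕ) : ℝ :=
  ∏ k : Fin n, if l ≤ k.val then
    ∏ j : Fin k, (if j.val < l then Real.cos (φ k j) else 1) else 1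

/-- The argument `α_1 + ∑_{j = l+1}^n α_j` of the complex phase, with one-based `j`. -/
def phaseArg {n : ℕ} (hn : 0 < n) (α : Fin n → ℝ) (l : ℕ) : ℝ :=
  α ⟨0, hn⟩ + ∑ j : Fin n, if l ≤ j.val then α j else 0

/-- The measure `dα / 2π` on `[-π, π)`. -/
def angleMeasure : Measure ℝ :=
  ENNReal.ofReal (1 / (2 * Real.pi)) • volume.restrict (Set.Ico (-Real.pi) Real.pi)

/-- The measure `2 d (cos φ)^{2d-1} sin φ dφ` on `[0, π/2]`. -/
def phiMeasure (d : ℕ) : Measure ℝ :=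
  (volume.restrict (Set.Icc 0 (Real.pi / 2))).withDensity fun φ =>
    ENNReal.ofReal (2 * (d : ℝ) * Real.cos φ ^ (2 * d - 1) * Real.sin φ)

/-- The product measure
`∏_{j<k} 2(k-j) (cos φ_{j,k})^{2(k-j)-1} sin φ_{j,k} dφ_{j,k} ∏_j dα_j/2π ∏_{j<k} dψ_{j,k}/2π`
on the triples `(α, φ, ψ)`. The subtraction does not truncate, since `j : Fin k`. -/
def coordMeasure (n : ℕ) : Measure ((Fin n → ℝ) × PairAngles n × PairAngles n) :=
  (Measure.pi fun _ : Fin n => angleMeasure).prod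
    ((Measure.pi fun k : Fin n => Measure.pi fun j : Fin k => phiMeasure (k.val - j.val)).prod
      (Measure.pi fun k : Fin n => Measure.pi fun _ : Fin k => angleMeasure))

/-- The unitary group carries its Borel `σ`-algebra. -/
instance instMeasurableSpaceUnitary (n : ℕ) : MeasurableSpace (unitaryGroup (Fin n) ℂ) :=
  borel _

instance instBorelSpaceUnitary (n : ℕ) : BorelSpace (unitaryGroup (Fin n) ℂ) := ⟨rfl⟩

end HurwitzU

end

/-!
Every proper leading block of `H_m` is upper triangular, so the leading minors of `V_m` are those of
`V_{m-1}` multiplied by diagonal entries of `H_m`, and the diagonal of `U` is a quotient of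
consecutive minors.

The last row of `V_m` is the last row of `H_m`, a point of the unit sphere of `ℂ^m` in spherical
coordinates, and two unitary matrices with the same last row differ by a left factor `diag(A, 1)`
with `A` unitary. Hence existence and uniqueness of the angles follow by induction from the
corresponding statements for the sphere.

For Haar measure, let `g` be Haar distributed on `U(m-1)` and let the last row of `H` be uniformly
distributed on the sphere. The average of a function over `g ↦ diag(g, 1) H` only depends on the
last row of `H`, and the sphere measure is invariant under unitary matrices; so the law of
`diag(g, 1) H` is invariant under right translations, that is, it is Haar measure. That spherical
coordinates produce the uniform measure comes from writing Lebesgue measure on `ℂ^m` in polar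
coordinates, one complex variable at a time.
-/

open scoped ENNReal

noncomputable section

namespace HurwitzU

section Embed

variable {ι κ R : Type*} [DecidableEq κ] [CommRing R]

/-- The matrix of the coordinate inclusion `R^ι → R^κ` along `e`. -/
def inclusionMatrix (R : Type*) [CommRing R] (e : ι ↪ κ) : Matrix κ ι R :=
  (1 : Matrix κ κ R).submatrix id e

variable [DecidableEq ι] (e : ι ↪ κ)

lemma transpose_inclusionMatrix_mul_self [Fintype κ] :
    (inclusionMatrix R e)ᵀ * inclusionMatrix R e = 1 := by
  ext x y
  simp [inclusionMatrix, Matrix.mul_apply, Matrix.one_apply]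

variable [Fintype ι]

/-- The `κ × κ` matrix that acts as `M` on the coordinates in the range of `e` and as the identity
on the others. Both `diagOne` and the plane rotations `phiMat` are of this form. -/
def embed (M : Matrix ι ι R) : Matrix κ κ R :=
  1 + inclusionMatrix R e * (M - 1) * (inclusionMatrix R e)ᵀ

lemma embed_apply_apply (M : Matrix ι ι R) (x y : ι) : embed e M (e x) (e y) = M x y := by
  simp [embed, inclusionMatrix, Matrix.mul_apply, Matrix.one_apply]

lemma embed_apply_of_notMem_range_left (M : Matrix ι ι R) {r : κ} (hr : r ∉ Set.range e) (s : κ) :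
    embed e M r s = (1 : Matrix κ κ R) r s := by
  have (x : ι) : r ≠ e x := fun h => hr ⟨x, h.symm⟩
  simp [embed, inclusionMatrix, Matrix.mul_apply, Matrix.one_apply, this]

lemma embed_apply_of_notMem_range_right (M : Matrix ι ι R) (r : κ) {s : κ}
    (hs : s ∉ Set.range e) : embed e M r s = (1 : Matrix κ κ R) r s := by
  have (x : ι) : e x ≠ s := fun h => hs ⟨x, h⟩
  simp [embed, inclusionMatrix, Matrix.mul_apply, Matrix.one_apply, this]

lemma embed_one : embed e (1 : Matrix ι ι R) = 1 := by simp [embed]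

lemma embed_injective : Function.Injective (embed e : Matrix ι ι R → Matrix κ κ R) := by
  intro M N h
  ext x y
  rw [← embed_apply_apply e M, h, embed_apply_apply]

lemma star_embed [StarRing R] (M : Matrix ι ι R) : star (embed e M) = embed e (star M) := by
  have h : (inclusionMatrix R e)ᴴ = ((inclusionMatrix R e)ᵀ : Matrix ι κ R) := by
    simp [inclusionMatrix, conjTranspose_submatrix, transpose_submatrix]
  have h' : (inclusionMatrix R e)ᵀᴴ = (inclusionMatrix R e : Matrix κ ι R) := by
    rw [← h, conjTranspose_conjTranspose]
  simp [embed, star_eq_conjTranspose, conjTranspose_mul, h, h', Matrix.mul_assoc]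

variable [Fintype κ]

lemma embed_mul (M N : Matrix ι ι R) : embed e (M * N) = embed e M * embed e N := by
  set P : Matrix κ ι R := inclusionMatrix R e with hP
  have hMN : M * N - 1 = (M - 1) + (N - 1) + (M - 1) * (Pᵀ * P) * (N - 1) := by
    rw [transpose_inclusionMatrix_mul_self]
    noncomm_ring
  simp only [embed, hMN, ← hP, Matrix.mul_add, Matrix.add_mul, Matrix.one_mul, Matrix.mul_one,
    Matrix.mul_assoc]
  abel

lemma det_embed (M : Matrix ι ι R) : (embed e M).det = M.det := by
  rw [embed, Matrix.mul_assoc, det_one_add_mul_comm, Matrix.mul_assoc,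
    transpose_inclusionMatrix_mul_self, Matrix.mul_one, add_sub_cancel]

lemma embed_mem_unitaryGroup [StarRing R] {M : Matrix ι ι R} :
    embed e M ∈ unitaryGroup κ R ↔ M ∈ unitaryGroup ι R := by
  rw [mem_unitaryGroup_iff, mem_unitaryGroup_iff, star_embed, ← embed_mul, ← embed_one e,
    (embed_injective e).eq_iff]

lemma mul_embed_apply (B : Matrix κ κ R) (M : Matrix ι ι R) (r : κ) (y : ι) :
    (B * embed e M) r (e y) = ∑ x, B r (e x) * M x y := by
  rw [Matrix.mul_apply]
  refine (Fintype.sum_of_injective e e.injective _ _ (fun k hk => ?_) fun x => ?_).symm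
  · rw [embed_apply_of_notMem_range_left e M hk, one_apply_ne, mul_zero]
    rintro rfl
    exact hk ⟨y, rfl⟩
  · rw [embed_apply_apply]

lemma mul_embed_apply_of_notMem_range (B : Matrix κ κ R) (M : Matrix ι ι R) (r : κ) {s : κ}
    (hs : s ∉ Set.range e) : (B * embed e M) r s = B r s := by
  simp [Matrix.mul_apply, embed_apply_of_notMem_range_right e M _ hs, Matrix.one_apply]

end Embed

section Exp

lemma star_exp_I_mul (x : ℝ) :
    star (Complex.exp (Complex.I * (x : ℂ))) = Complex.exp (-(Complex.I * (x : ℂ))) := by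
  simp [← Complex.exp_conj]

lemma exp_neg_I_mul_mul_exp_I_mul (x : ℝ) :
    Complex.exp (-(Complex.I * (x : ℂ))) * Complex.exp (Complex.I * (x : ℂ)) = 1 := by
  rw [← Complex.exp_add, neg_add_cancel, Complex.exp_zero]

lemma norm_exp_I_mul (x : ℝ) : ‖Complex.exp (Complex.I * (x : ℂ))‖ = 1 := by
  rw [mul_comm, Complex.norm_exp_ofReal_mul_I]

lemma norm_exp_neg_I_mul (x : ℝ) : ‖Complex.exp (-(Complex.I * (x : ℂ)))‖ = 1 := by
  rw [← star_exp_I_mul, norm_star, norm_exp_I_mul]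

end Exp

section Rotation

/-- The general element `[[c̄, -s̄], [s, c]]` of `SU(2)`, where `|c|² + |s|² = 1`. -/
def rotationBlock (c s : ℂ) : Matrix (Fin 2) (Fin 2) ℂ := !![star c, -star s; s, c]

lemma det_rotationBlock {c s : ℂ} (h : c * star c + s * star s = 1) :
    (rotationBlock c s).det = 1 := by
  rw [rotationBlock, det_fin_two_of]
  linear_combination h

lemma rotationBlock_mem_unitaryGroup {c s : ℂ} (h : c * star c + s * star s = 1) :
    rotationBlock c s ∈ unitaryGroup (Fin 2) ℂ := by
  have hstar : star (rotationBlock c s) = !![c, star s; -s, star c] := by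
    ext i j
    fin_cases i <;> fin_cases j <;> simp [rotationBlock, star_apply]
  have h' : star c * c + -star s * -s = 1 := by linear_combination h
  rw [mem_unitaryGroup_iff, hstar, rotationBlock, mul_fin_two, one_fin_two, h',
    show s * star s + c * star c = 1 by rw [add_comm, h]]
  congr 2 <;> ring_nf

end Rotation

section phiMat

variable {m : ℕ}

/-- The lower right entry `e^{-ia} cos φ_{j,n}` of `Φ_{j,n}`, where `a = α` in the first factor and
`a = 0` in the others. -/
def cosCoef (α : ℝ) (φ : Fin m → ℝ) (j : Fin m) : ℂ :=
  Complex.exp (-(Complex.I * ((if j.val = 0 then α else 0 : ℝ) : ℂ))) * (Real.cos (φ j) : ℂ)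

/-- The lower left entry `-e^{-iψ_{j,n}} sin φ_{j,n}` of `Φ_{j,n}`. -/
def sinCoef (φ ψ : Fin m → ℝ) (j : Fin m) : ℂ :=
  -(Complex.exp (-(Complex.I * (ψ j : ℂ))) * (Real.sin (φ j) : ℂ))

/-- The embedding of the plane spanned by the coordinates `j` and `n`, on which `Φ_{j,n}` acts. -/
def planeEmbedding (j : Fin m) : Fin 2 ↪ Fin (m + 1) where
  toFun := ![j.castSucc, Fin.last m]
  inj' x y h := by
    fin_cases x <;> fin_cases y <;> simp_all [j.castSucc_ne_last, j.castSucc_ne_last.symm]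

variable (α : ℝ) (φ ψ : Fin m → ℝ) (j : Fin m)

lemma planeEmbedding_zero : planeEmbedding j 0 = j.castSucc := rfl

lemma planeEmbedding_one : planeEmbedding j 1 = Fin.last m := rfl

lemma mem_range_planeEmbedding {r : Fin (m + 1)} :
    r ∈ Set.range (planeEmbedding j) ↔ r = j.castSucc ∨ r = Fin.last m := by
  simp only [Set.mem_range, Fin.exists_fin_two, planeEmbedding_zero, planeEmbedding_one, eq_comm]

lemma cosCoef_mul_star_add_sinCoef_mul_star :
    cosCoef α φ j * star (cosCoef α φ j) + sinCoef φ ψ j * star (sinCoef φ ψ j) = 1 := by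
  have h : ((Real.cos (φ j) ^ 2 + Real.sin (φ j) ^ 2 : ℝ) : ℂ) = 1 := by
    rw [Real.cos_sq_add_sin_sq, Complex.ofReal_one]
  have hnorm (z : ℂ) (x : ℝ) (hz : ‖z‖ = 1) : (z * x) * star (z * x) = (x ^ 2 : ℝ) := by
    rw [Complex.star_def, Complex.mul_conj', norm_mul, hz, one_mul, Complex.norm_real,
      ← Complex.ofReal_pow, Real.norm_eq_abs, sq_abs]
  rw [cosCoef, sinCoef, star_neg, neg_mul_neg, hnorm _ _ (norm_exp_neg_I_mul _),
    hnorm _ _ (norm_exp_neg_I_mul _), ← Complex.ofReal_add, h]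

lemma phiMat_eq_embed : phiMat α φ ψ j =
    embed (planeEmbedding j) (rotationBlock (cosCoef α φ j) (sinCoef φ ψ j)) := by
  have hne : Fin.last m ≠ j.castSucc := j.castSucc_ne_last.symm
  ext r s
  by_cases hr : r ∈ Set.range (planeEmbedding j)
  · by_cases hs : s ∈ Set.range (planeEmbedding j)
    · obtain ⟨x, rfl⟩ := hr
      obtain ⟨y, rfl⟩ := hs
      rw [embed_apply_apply]
      fin_cases x <;> fin_cases y <;>
        simp [planeEmbedding_zero, planeEmbedding_one, phiMat, rotationBlock, cosCoef, sinCoef,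
          hne, hne.symm, ← Complex.exp_conj, ← Complex.cos_conj, ← Complex.sin_conj]
    · rw [embed_apply_of_notMem_range_right _ _ _ hs]
      rw [mem_range_planeEmbedding, not_or] at hs
      simp [phiMat, hs.1, hs.2, Matrix.one_apply]
  · rw [embed_apply_of_notMem_range_left _ _ hr]
    rw [mem_range_planeEmbedding, not_or] at hr
    simp [phiMat, hr.1, hr.2, Matrix.one_apply]

lemma phiMat_mem_unitaryGroup : phiMat α φ ψ j ∈ unitaryGroup (Fin (m + 1)) ℂ := by
  rw [phiMat_eq_embed, embed_mem_unitaryGroup]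
  exact rotationBlock_mem_unitaryGroup (cosCoef_mul_star_add_sinCoef_mul_star α φ ψ j)

lemma det_phiMat : (phiMat α φ ψ j).det = 1 := by
  rw [phiMat_eq_embed, det_embed]
  exact det_rotationBlock (cosCoef_mul_star_add_sinCoef_mul_star α φ ψ j)

variable (B : Matrix (Fin (m + 1)) (Fin (m + 1)) ℂ) (r : Fin (m + 1))

lemma mul_phiMat_apply_castSucc_self : (B * phiMat α φ ψ j) r j.castSucc =
    B r j.castSucc * star (cosCoef α φ j) + B r (Fin.last m) * sinCoef φ ψ j := by
  rw [phiMat_eq_embed]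
  exact (mul_embed_apply (planeEmbedding j) B _ r 0).trans (Fin.sum_univ_two _)

lemma mul_phiMat_apply_castSucc_of_ne {j s : Fin m} (h : s ≠ j) :
    (B * phiMat α φ ψ j) r s.castSucc = B r s.castSucc := by
  rw [phiMat_eq_embed]
  refine mul_embed_apply_of_notMem_range _ _ _ _ ?_
  rw [mem_range_planeEmbedding, not_or]
  exact ⟨(Fin.castSucc_injective m).ne h, s.castSucc_ne_last⟩

lemma mul_phiMat_apply_last : (B * phiMat α φ ψ j) r (Fin.last m) =
    B r j.castSucc * -star (sinCoef φ ψ j) + B r (Fin.last m) * cosCoef α φ j := by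
  rw [phiMat_eq_embed]
  exact (mul_embed_apply (planeEmbedding j) B _ r 1).trans (Fin.sum_univ_two _)

end phiMat

section prodH

variable {m : ℕ} (α : ℝ) (φ ψ : Fin m → ℝ)

lemma prodH_mem_unitaryGroup : prodH α φ ψ ∈ unitaryGroup (Fin (m + 1)) ℂ := by
  refine Submonoid.list_prod_mem _ fun A hA => ?_
  obtain ⟨j, rfl⟩ := (List.mem_ofFn' _ _).1 hA
  exact phiMat_mem_unitaryGroup α φ ψ j

lemma det_prodH : (prodH α φ ψ).det = 1 := by
  rw [prodH, ← Matrix.coe_detMonoidHom, map_list_prod]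
  refine List.prod_eq_one fun x hx => ?_
  obtain ⟨A, hA, rfl⟩ := List.mem_map.1 hx
  obtain ⟨j, rfl⟩ := (List.mem_ofFn' _ _).1 hA
  exact det_phiMat α φ ψ j

/-- The product of the first `t` factors of `prodH`. -/
def partialH (t : ℕ) (ht : t ≤ m) : Matrix (Fin (m + 1)) (Fin (m + 1)) ℂ :=
  (List.ofFn fun i : Fin t => phiMat α φ ψ (Fin.castLE ht i)).prod

lemma partialH_zero : partialH α φ ψ 0 m.zero_le = 1 := by simp [partialH]

lemma partialH_self : partialH α φ ψ m le_rfl = prodH α φ ψ := rfl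

lemma partialH_succ (t : ℕ) (ht : t + 1 ≤ m) :
    partialH α φ ψ (t + 1) ht =
      partialH α φ ψ t (Nat.le_of_succ_le ht) * phiMat α φ ψ ⟨t, ht⟩ := by
  rw [partialH, List.ofFn_succ', List.prod_concat]
  rfl

lemma partialH_apply_castSucc_of_le (t : ℕ) (ht : t ≤ m) (r : Fin (m + 1)) {s : Fin m}
    (h : t ≤ s) : partialH α φ ψ t ht r s.castSucc =
      (1 : Matrix (Fin (m + 1)) (Fin (m + 1)) ℂ) r s.castSucc := by
  induction t with
  | zero => rw [partialH_zero]
  | succ t ih =>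
    have hne : s ≠ ⟨t, ht⟩ := Fin.ne_of_val_ne (Nat.lt_of_succ_le h).ne'
    rw [partialH_succ, mul_phiMat_apply_castSucc_of_ne _ _ _ _ _ hne,
      ih _ (Nat.le_of_succ_le h)]

lemma partialH_castSucc_last_of_le (t : ℕ) (ht : t ≤ m) {r : Fin m} (h : t ≤ r) :
    partialH α φ ψ t ht r.castSucc (Fin.last m) = 0 := by
  induction t with
  | zero => rw [partialH_zero, one_apply_ne r.castSucc_ne_last]
  | succ t ih =>
    have hne : r ≠ ⟨t, ht⟩ := Fin.ne_of_val_ne (Nat.lt_of_succ_le h).ne'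
    rw [partialH_succ, mul_phiMat_apply_last, ih _ (Nat.le_of_succ_le h),
      partialH_apply_castSucc_of_le _ _ _ _ _ _ (s := ⟨t, ht⟩) le_rfl,
      one_apply_ne ((Fin.castSucc_injective m).ne hne), zero_mul, zero_mul, add_zero]

lemma partialH_last_last (t : ℕ) (ht : t ≤ m) : partialH α φ ψ t ht (Fin.last m) (Fin.last m) =
    ∏ i : Fin t, cosCoef α φ (Fin.castLE ht i) := by
  induction t with
  | zero => simp [partialH_zero]
  | succ t ih =>
    rw [partialH_succ, mul_phiMat_apply_last,
      partialH_apply_castSucc_of_le _ _ _ _ _ _ (s := ⟨t, ht⟩) le_rfl,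
      one_apply_ne (Fin.castSucc_ne_last _).symm, zero_mul, zero_add, ih, Fin.prod_univ_castSucc]
    rfl

/-- Column `s` is changed only by the factor `Φ_{s,n}`. -/
lemma prodH_apply_castSucc (r : Fin (m + 1)) (s : Fin m) : prodH α φ ψ r s.castSucc =
    (1 : Matrix (Fin (m + 1)) (Fin (m + 1)) ℂ) r s.castSucc * star (cosCoef α φ s) +
      partialH α φ ψ s s.is_le' r (Fin.last m) * sinCoef φ ψ s := by
  have key (t : ℕ) (ht : t ≤ m) (hst : s + 1 ≤ t) :
      partialH α φ ψ t ht r s.castSucc = partialH α φ ψ (s + 1) s.isLt r s.castSucc := by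
    induction t, hst using Nat.le_induction with
    | base => rfl
    | succ t hst ih =>
      rw [partialH_succ, mul_phiMat_apply_castSucc_of_ne _ _ _ _ _ (Fin.ne_of_val_ne ?_), ih]
      exact (Nat.lt_of_succ_le hst).ne
  rw [← partialH_self, key m le_rfl s.isLt, partialH_succ, mul_phiMat_apply_castSucc_self,
    partialH_apply_castSucc_of_le _ _ _ _ _ _ le_rfl]

lemma prodH_castSucc_castSucc_of_le {r s : Fin m} (h : s ≤ r) :
    prodH α φ ψ r.castSucc s.castSucc = if r = s then star (cosCoef α φ s) else 0 := by
  rw [prodH_apply_castSucc, partialH_castSucc_last_of_le _ _ _ _ _ h]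
  simp [Matrix.one_apply]

end prodH

/-- The vector `(t₀, k₀ t₁, k₀ k₁ t₂, …, k₀ ⋯ k_{d-1})`; spherical coordinates on `ℂ^{d+1}` for
cosines `k` and sines `t`. -/
def sphericalVec : (d : ℕ) → (Fin d → ℂ) → (Fin d → ℂ) → Fin (d + 1) → ℂ
  | 0, _, _ => fun _ => 1
  | d + 1, k, t => Fin.cons (t 0) (k 0 • sphericalVec d (fun i => k i.succ) fun i => t i.succ)

lemma sphericalVec_last (d : ℕ) (k t : Fin d → ℂ) :
    sphericalVec d k t (Fin.last d) = ∏ i, k i := by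
  induction d with
  | zero => simp [sphericalVec]
  | succ d ih =>
    rw [sphericalVec, ← Fin.succ_last, Fin.cons_succ, Pi.smul_apply, ih, Fin.prod_univ_succ,
      smul_eq_mul]

lemma sphericalVec_castSucc (d : ℕ) (k t : Fin d → ℂ) (s : Fin d) :
    sphericalVec d k t s.castSucc = (∏ i : Fin s.val, k (Fin.castLE s.isLt.le i)) * t s := by
  induction d with
  | zero => exact s.elim0
  | succ d ih =>
    cases s using Fin.cases with
    | zero =>
      rw [sphericalVec, Fin.castSucc_zero, Fin.cons_zero]
      exact (one_mul _).symm
    | succ s =>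
      rw [sphericalVec, ← Fin.succ_castSucc, Fin.cons_succ, Pi.smul_apply, ih, smul_eq_mul,
        ← mul_assoc]
      congr 1
      exact (Fin.prod_univ_succ (n := s.val)
        fun i : Fin (s.val + 1) => k (Fin.castLE s.succ.isLt.le i)).symm

lemma prodH_last {m : ℕ} (α : ℝ) (φ ψ : Fin m → ℝ) :
    prodH α φ ψ (Fin.last m) = sphericalVec m (cosCoef α φ) (sinCoef φ ψ) := by
  ext s
  cases s using Fin.lastCases with
  | last =>
    rw [← partialH_self, partialH_last_last, sphericalVec_last]
    rfl
  | cast s =>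
    rw [prodH_apply_castSucc, one_apply_ne s.castSucc_ne_last.symm, zero_mul, zero_add,
      partialH_last_last, sphericalVec_castSucc]

section diagOne

variable {m : ℕ} (A B : Matrix (Fin m) (Fin m) ℂ)

lemma last_notMem_range_castSuccEmb : Fin.last m ∉ Set.range (Fin.castSuccEmb (n := m)) := by
  rintro ⟨i, hi⟩
  exact i.castSucc_ne_last hi

lemma diagOne_eq_embed : diagOne A = embed Fin.castSuccEmb A := by
  have hinl (i : Fin m) : finSumFinEquiv.symm i.castSucc = Sum.inl i :=
    finSumFinEquiv_symm_apply_castAdd i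
  ext r s
  cases r using Fin.lastCases with
  | last =>
    rw [embed_apply_of_notMem_range_left _ _ last_notMem_range_castSuccEmb]
    cases s using Fin.lastCases <;> simp [diagOne, hinl, (Fin.castSucc_ne_last _).symm]
  | cast r =>
    cases s using Fin.lastCases with
    | last =>
      rw [embed_apply_of_notMem_range_right _ _ _ last_notMem_range_castSuccEmb]
      simp [diagOne, hinl]
    | cast s => exact (by simp [diagOne, hinl] : _ = A r s).trans (embed_apply_apply ..).symm

lemma diagOne_castSucc_castSucc (i j : Fin m) : diagOne A i.castSucc j.castSucc = A i j := by
  rw [diagOne_eq_embed]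
  exact embed_apply_apply ..

lemma diagOne_apply_last (i : Fin (m + 1)) :
    diagOne A i (Fin.last m) = (1 : Matrix (Fin (m + 1)) (Fin (m + 1)) ℂ) i (Fin.last m) := by
  rw [diagOne_eq_embed, embed_apply_of_notMem_range_right _ _ _ last_notMem_range_castSuccEmb]

lemma diagOne_last : diagOne A (Fin.last m) = Pi.single (Fin.last m) 1 := by
  ext s
  rw [diagOne_eq_embed, embed_apply_of_notMem_range_left _ _ last_notMem_range_castSuccEmb,
    one_eq_pi_single]

lemma diagOne_mul : diagOne (A * B) = diagOne A * diagOne B := by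
  simp only [diagOne_eq_embed, embed_mul]

lemma det_diagOne : (diagOne A).det = A.det := by rw [diagOne_eq_embed, det_embed]

lemma diagOne_injective : Function.Injective (diagOne (m := m)) := by
  intro A B h
  simpa only [diagOne_eq_embed, (embed_injective _).eq_iff] using h

variable {A} in
lemma diagOne_mem_unitaryGroup :
    diagOne A ∈ unitaryGroup (Fin (m + 1)) ℂ ↔ A ∈ unitaryGroup (Fin m) ℂ := by
  rw [diagOne_eq_embed, embed_mem_unitaryGroup]

lemma diagOne_mul_last (M : Matrix (Fin (m + 1)) (Fin (m + 1)) ℂ) :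
    (diagOne A * M) (Fin.last m) = M (Fin.last m) := by
  rw [mul_apply_eq_vecMul, diagOne_last, single_one_vecMul]
  rfl

lemma exists_eq_diagOne {W : Matrix (Fin (m + 1)) (Fin (m + 1)) ℂ}
    (hW : W ∈ unitaryGroup (Fin (m + 1)) ℂ) (hlast : W (Fin.last m) = Pi.single (Fin.last m) 1) :
    ∃ A ∈ unitaryGroup (Fin m) ℂ, W = diagOne A := by
  have hcol (i : Fin m) : W i.castSucc (Fin.last m) = 0 := by
    have h := congrFun (congrFun (mem_unitaryGroup_iff.1 hW) i.castSucc) (Fin.last m)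
    rw [Matrix.mul_apply, one_apply_ne i.castSucc_ne_last] at h
    simpa [star_apply, hlast, Pi.single_apply] using h
  have hWA : W = diagOne (W.submatrix Fin.castSucc Fin.castSucc) := by
    ext r s
    cases r using Fin.lastCases with
    | last => rw [hlast, diagOne_last]
    | cast r =>
      cases s using Fin.lastCases with
      | last => rw [hcol, diagOne_apply_last, one_apply_ne r.castSucc_ne_last]
      | cast s => rw [diagOne_castSucc_castSucc, submatrix_apply]
  rw [hWA] at hW
  exact ⟨_, diagOne_mem_unitaryGroup.1 hW, hWA⟩

end diagOne

lemma V_mem_unitaryGroup : ∀ (n : ℕ) (α : Fin n → ℝ) (φ ψ : PairAngles n),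
    V n α φ ψ ∈ unitaryGroup (Fin n) ℂ
  | 0, _, _, _ => one_mem _
  | 1, α, φ, ψ => by
    rw [mem_unitaryGroup_iff]
    ext i j
    rw [Subsingleton.elim i 0, Subsingleton.elim j 0]
    simp only [V, Matrix.mul_apply, Fin.sum_univ_one, star_apply, of_apply, one_apply_eq]
    rw [star_exp_I_mul, mul_comm, exp_neg_I_mul_mul_exp_I_mul]
  | m + 2, _, _, _ =>
    mul_mem (diagOne_mem_unitaryGroup.2 (V_mem_unitaryGroup (m + 1) _ _ _))
      (prodH_mem_unitaryGroup _ _ _)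

lemma det_V : ∀ (n : ℕ) (hn : 0 < n) (α : Fin n → ℝ) (φ ψ : PairAngles n),
    (V n α φ ψ).det = Complex.exp (Complex.I * (α ⟨0, hn⟩ : ℂ))
  | 1, _, _, _, _ => det_fin_one _
  | m + 2, _, _, _, _ => by
    rw [V, det_mul, det_diagOne, det_prodH, mul_one, det_V (m + 1) m.succ_pos]
    rfl

section Minors

variable {n m : ℕ}

lemma leading_mul (A B : Matrix (Fin n) (Fin n) ℂ) (l : ℕ) (hl : l ≤ n)
    (h : ∀ i j k : Fin n, i < l → j < l → l ≤ k → A i k * B k j = 0) :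
    leading (A * B) l hl = leading A l hl * leading B l hl := by
  ext i j
  rw [leading, submatrix_apply, Matrix.mul_apply, Matrix.mul_apply]
  refine (Fintype.sum_of_injective (Fin.castLE hl) (Fin.castLE_injective hl) _ _
    (fun k hk => h _ _ k i.isLt j.isLt ?_) fun k => rfl).symm
  by_contra! hkl
  exact hk ⟨⟨k, hkl⟩, rfl⟩

lemma leading_diagOne (A : Matrix (Fin m) (Fin m) ℂ) (l : ℕ) (hl : l ≤ m) :
    leading (diagOne A) l (hl.trans m.le_succ) = leading A l hl := by
  ext i j
  exact diagOne_castSucc_castSucc A (Fin.castLE hl i) (Fin.castLE hl j)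

lemma prod_star_cosCoef (α : ℝ) (φ : Fin m → ℝ) (l : ℕ) (hl1 : 1 ≤ l) (hl : l ≤ m) :
    ∏ j : Fin l, star (cosCoef α φ (Fin.castLE hl j)) = Complex.exp (Complex.I * (α : ℂ)) *
      ((∏ j : Fin l, Real.cos (φ (Fin.castLE hl j)) : ℝ) : ℂ) := by
  obtain ⟨l, rfl⟩ := Nat.exists_eq_add_of_le' hl1
  have hstar (j : Fin m) : star (cosCoef α φ j) =
      Complex.exp (Complex.I * ((if j.val = 0 then α else 0 : ℝ) : ℂ)) * (Real.cos (φ j) : ℂ) := by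
    rw [cosCoef, ← star_exp_I_mul, star_mul', star_star, Complex.star_def, Complex.conj_ofReal]
  simp only [hstar, Finset.prod_mul_distrib, Complex.ofReal_prod]
  rw [Fin.prod_univ_succ, Finset.prod_eq_one fun j _ => ?_]
  · simp
  · simp

lemma det_leading_prodH (α : ℝ) (φ ψ : Fin m → ℝ) (l : ℕ) (hl1 : 1 ≤ l) (hl : l ≤ m) :
    (leading (prodH α φ ψ) l (hl.trans m.le_succ)).det = Complex.exp (Complex.I * (α : ℂ)) *
      ((∏ j : Fin l, Real.cos (φ (Fin.castLE hl j)) : ℝ) : ℂ) := by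
  have hentry {i j : Fin l} (hji : j ≤ i) :
      leading (prodH α φ ψ) l (hl.trans m.le_succ) i j =
        if Fin.castLE hl i = Fin.castLE hl j then star (cosCoef α φ (Fin.castLE hl j)) else 0 :=
    prodH_castSucc_castSucc_of_le α φ ψ (r := Fin.castLE hl i) (s := Fin.castLE hl j) hji
  rw [det_of_isUpperTriangular, ← prod_star_cosCoef α φ l hl1 hl]
  · exact Finset.prod_congr rfl fun j _ => (hentry le_rfl).trans (if_pos rfl)
  · intro i j hji
    exact (hentry hji.le).trans (if_neg ((Fin.castLE_injective hl).ne hji.ne'))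

lemma det_leading_diagOne_mul_prodH (A : Matrix (Fin m) (Fin m) ℂ) (α : ℝ) (φ ψ : Fin m → ℝ)
    (l : ℕ) (hl1 : 1 ≤ l) (hl : l ≤ m) :
    (leading (diagOne A * prodH α φ ψ) l (hl.trans m.le_succ)).det =
      (leading A l hl).det * (Complex.exp (Complex.I * (α : ℂ)) *
        ((∏ j : Fin l, Real.cos (φ (Fin.castLE hl j)) : ℝ) : ℂ)) := by
  rw [leading_mul, det_mul, leading_diagOne, det_leading_prodH α φ ψ l hl1 hl]
  intro i j k hi hj hk
  cases k using Fin.lastCases with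
  | last =>
    rw [diagOne_apply_last, one_apply_ne (Fin.ne_of_val_ne (hi.trans_le hl).ne), zero_mul]
  | cast k =>
    have hjk : (⟨j, hj.trans_le hl⟩ : Fin m) < k := hj.trans_le hk
    refine mul_eq_zero_of_right _ ?_
    exact (prodH_castSucc_castSucc_of_le α φ ψ hjk.le).trans (if_neg hjk.ne')

lemma radius_self (φ : PairAngles n) : radius φ n = 1 :=
  Finset.prod_eq_one fun k _ => if_neg k.isLt.not_ge

lemma phaseArg_self (hn : 0 < n) (α : Fin n → ℝ) : phaseArg hn α n = α ⟨0, hn⟩ := by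
  rw [phaseArg, Finset.sum_eq_zero fun k _ => if_neg k.isLt.not_ge, add_zero]

lemma radius_succ (φ : PairAngles (n + 1)) (l : ℕ) (hl : l ≤ n) :
    radius φ l = radius (fun k => φ k.castSucc) l *
      ∏ j : Fin l, Real.cos (φ (Fin.last n) (Fin.castLE hl j)) := by
  rw [radius, Fin.prod_univ_castSucc, if_pos (show l ≤ (Fin.last n).val from hl)]
  congr 1
  exact (Fintype.prod_of_injective (Fin.castLE hl) (Fin.castLE_injective hl) _ _
    (fun j hj => if_neg fun h => hj ⟨⟨j, h⟩, rfl⟩) fun j => by simp).symm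

lemma phaseArg_succ (hn : 0 < n) (α : Fin (n + 1) → ℝ) (l : ℕ) (hl : l ≤ n) :
    phaseArg n.succ_pos α l = phaseArg hn (fun k => α k.castSucc) l + α (Fin.last n) := by
  rw [phaseArg, phaseArg, Fin.sum_univ_castSucc, Fin.val_last, if_pos hl, add_assoc]
  rfl

lemma det_leading_V (hn : 0 < n) (α : Fin n → ℝ) (φ ψ : PairAngles n) (l : ℕ) (hl1 : 1 ≤ l)
    (hl : l ≤ n) : (leading (V n α φ ψ) l hl).det =
      (radius φ l : ℂ) * Complex.exp (Complex.I * (phaseArg hn α l : ℂ)) := by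
  induction n with
  | zero => exact absurd hn (lt_irrefl 0)
  | succ n ih =>
    rcases hl.eq_or_lt with rfl | hln
    · rw [radius_self, phaseArg_self, Complex.ofReal_one, one_mul, ← det_V (n + 1) hn α φ ψ]
      rfl
    · have hln := Nat.le_of_lt_succ hln
      obtain ⟨m, rfl⟩ := Nat.exists_eq_add_of_le' (hl1.trans hln)
      rw [V, det_leading_diagOne_mul_prodH _ _ _ _ l hl1 hln, ih m.succ_pos,
        radius_succ φ l hln, phaseArg_succ m.succ_pos α l hln]
      push_cast
      rw [mul_add, Complex.exp_add]
      ring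

end Minors

section Radius

variable {n : ℕ}

/-- `cos φ_{j,k}` for `j < k`, and `1` otherwise, so that products over pairs `j < k` become
products over unrestricted indices. -/
def cosOrOne (φ : PairAngles n) (k : Fin n) (j : ℕ) : ℝ :=
  if h : j < k.val then Real.cos (φ k ⟨j, h⟩) else 1

lemma cosOrOne_val (φ : PairAngles n) (k : Fin n) (j : Fin k) :
    cosOrOne φ k j = Real.cos (φ k j) :=
  dif_pos j.isLt

lemma cosOrOne_of_le (φ : PairAngles n) {k : Fin n} {j : ℕ} (h : k.val ≤ j) :
    cosOrOne φ k j = 1 :=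
  dif_neg h.not_gt

lemma prod_range_cosOrOne (φ : PairAngles n) (k : Fin n) :
    ∏ j ∈ Finset.range k, cosOrOne φ k j = ∏ j : Fin k, Real.cos (φ k j) := by
  simp only [Finset.prod_range, cosOrOne_val]

lemma prod_cosOrOne (φ : PairAngles n) (l : Fin n) :
    ∏ k : Fin n, cosOrOne φ k l = ∏ k : {k : Fin n // l < k}, Real.cos (φ k.1 ⟨l, k.2⟩) :=
  (Fintype.prod_of_injective Subtype.val Subtype.val_injective _ _
    (fun k hk => dif_neg fun h => hk ⟨⟨k, h⟩, rfl⟩) fun k => by simp [cosOrOne, k.2]).symm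

lemma radius_eq_prod_cosOrOne (φ : PairAngles n) (l : ℕ) : radius φ l =
    ∏ k : Fin n, if l ≤ k.val then ∏ j ∈ Finset.range l, cosOrOne φ k j else 1 := by
  refine Finset.prod_congr rfl fun k _ => ?_
  split_ifs with hlk
  · rw [Finset.prod_range]
    refine (Fintype.prod_of_injective (Fin.castLE hlk) (Fin.castLE_injective hlk) _ _
      (fun j hj => if_neg fun h => hj ⟨⟨j, h⟩, rfl⟩) fun j => ?_).symm
    rw [if_pos (by simp), ← cosOrOne_val, Fin.val_castLE]
  · rfl

lemma radius_succ_mul_prod_cos (φ : PairAngles n) (l : Fin n) :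
    radius φ (l + 1) * ∏ j : Fin l, Real.cos (φ l j) =
      radius φ l * ∏ k : {k : Fin n // l < k}, Real.cos (φ k.1 ⟨l, k.2⟩) := by
  have hrow : ∏ j ∈ Finset.range l, cosOrOne φ l j =
      ∏ k : Fin n, if k = l then ∏ j ∈ Finset.range l, cosOrOne φ k j else 1 := by
    rw [Finset.prod_ite_eq' Finset.univ l, if_pos (Finset.mem_univ _)]
  rw [← prod_range_cosOrOne, ← prod_cosOrOne, radius_eq_prod_cosOrOne, radius_eq_prod_cosOrOne,
    hrow, ← Finset.prod_mul_distrib, ← Finset.prod_mul_distrib]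
  refine Finset.prod_congr rfl fun k _ => ?_
  rcases lt_trichotomy k l with hkl | rfl | hlk
  · have hkl' : k.val < l.val := hkl
    rw [if_neg (by omega), if_neg hkl.ne, if_neg (by omega), cosOrOne_of_le φ hkl'.le]
  · rw [if_neg (by omega), if_pos rfl, if_pos le_rfl, cosOrOne_of_le φ le_rfl, one_mul, mul_one]
  · have hlk' : l.val < k.val := hlk
    rw [if_pos (Nat.succ_le_of_lt hlk'), if_neg hlk.ne', if_pos hlk'.le, Finset.prod_range_succ,
      mul_one]

lemma radius_zero (φ : PairAngles n) : radius φ 0 = 1 := by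
  simp [radius]

lemma radius_one (hn : 0 < n) (φ : PairAngles n) : radius φ 1 =
    ∏ k : {k : Fin n // ⟨0, hn⟩ < k}, Real.cos (φ k.1 ⟨0, k.2⟩) := by
  simpa [radius_zero] using radius_succ_mul_prod_cos φ ⟨0, hn⟩

lemma prod_cos_ne_zero_of_radius_ne_zero {φ : PairAngles n} {l : Fin n} (h : radius φ l ≠ 0) :
    ∏ j : Fin l, Real.cos (φ l j) ≠ 0 := by
  have hl := Finset.prod_ne_zero_iff.1 h l (Finset.mem_univ l)
  simpa only [le_refl, if_true, Fin.is_lt] using hl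

lemma radius_nonneg {φ : PairAngles n} (h : ∀ k j, 0 ≤ Real.cos (φ k j)) (l : ℕ) :
    0 ≤ radius φ l := by
  refine Finset.prod_nonneg fun k _ => ?_
  split_ifs
  · refine Finset.prod_nonneg fun j _ => ?_
    split_ifs
    exacts [h k j, zero_le_one]
  · exact zero_le_one

lemma InRange.cos_nonneg {α : Fin n → ℝ} {φ ψ : PairAngles n} (h : InRange α φ ψ) (k : Fin n)
    (j : Fin k) : 0 ≤ Real.cos (φ k j) :=
  Real.cos_nonneg_of_mem_Icc ⟨by linarith [(h.phi k j).1, Real.pi_pos], (h.phi k j).2⟩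

lemma phaseArg_eq_phaseArg_succ_add (hn : 0 < n) (α : Fin n → ℝ) (l : Fin n) :
    phaseArg hn α l = phaseArg hn α (l + 1) + α l := by
  have hsingle : α l = ∑ j : Fin n, if j = l then α j else 0 := by simp
  rw [phaseArg, phaseArg, hsingle, add_assoc, ← Finset.sum_add_distrib]
  congr 1
  refine Finset.sum_congr rfl fun k _ => ?_
  simp only [Fin.ext_iff]
  split_ifs <;> first | omega | simp

lemma phaseArg_one (hn : 0 < n) (α : Fin n → ℝ) : phaseArg hn α 1 = ∑ j, α j := by
  have h := phaseArg_eq_phaseArg_succ_add hn α ⟨0, hn⟩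
  simp only [zero_add, phaseArg, Nat.zero_le, if_true] at h ⊢
  linarith

end Radius

section LU

variable {n : ℕ} {L U : Matrix (Fin n) (Fin n) ℂ}

lemma IsLU.det_leading {A : Matrix (Fin n) (Fin n) ℂ} (h : IsLU A L U) (l : ℕ) (hl : l ≤ n) :
    (leading A l hl).det = ∏ i : Fin l, U (Fin.castLE hl i) (Fin.castLE hl i) := by
  rw [h.eq, leading_mul, det_mul,
    det_of_isLowerTriangular (M := leading L l hl) fun i j hij => h.lower _ _ hij,
    det_of_isUpperTriangular (M := leading U l hl) fun i j hij => h.upper _ _ hij]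
  · simp only [leading, submatrix_apply, h.unit, Finset.prod_const_one, one_mul]
  · intro i j k hi _ hk
    rw [h.lower i k (hi.trans_le hk), zero_mul]

variable {α : Fin n → ℝ} {φ ψ : PairAngles n}

lemma IsLU.prod_diag (hn : 0 < n) (hLU : IsLU (V n α φ ψ) L U) (l : ℕ) (hl1 : 1 ≤ l)
    (hl : l ≤ n) : ∏ i : Fin l, U (Fin.castLE hl i) (Fin.castLE hl i) =
      (radius φ l : ℂ) * Complex.exp (Complex.I * (phaseArg hn α l : ℂ)) := by
  rw [← hLU.det_leading, det_leading_V hn α φ ψ l hl1 hl]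

lemma IsLU.diag_ne_zero (hn : 0 < n) (hLU : IsLU (V n α φ ψ) L U) (i : Fin n) : U i i ≠ 0 := by
  have hdet : ∏ i, U i i ≠ 0 := by
    rw [← show (V n α φ ψ).det = ∏ i, U i i from hLU.det_leading n le_rfl, det_V n hn]
    exact Complex.exp_ne_zero _
  exact Finset.prod_ne_zero_iff.1 hdet i (Finset.mem_univ _)

lemma IsLU.radius_ne_zero (hn : 0 < n) (hLU : IsLU (V n α φ ψ) L U) (l : ℕ) (hl1 : 1 ≤ l)
    (hl : l ≤ n) : radius φ l ≠ 0 := by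
  have hprod := Finset.prod_ne_zero_iff.2
    fun (i : Fin l) (_ : i ∈ Finset.univ) => hLU.diag_ne_zero hn (Fin.castLE hl i)
  rw [hLU.prod_diag hn l hl1 hl] at hprod
  exact Complex.ofReal_ne_zero.1 (left_ne_zero_of_mul hprod)

lemma IsLU.radius_pos (hn : 0 < n) (hLU : IsLU (V n α φ ψ) L U)
    (hcos : ∀ k j, 0 ≤ Real.cos (φ k j)) (l : ℕ) (hl1 : 1 ≤ l) (hl : l ≤ n) : 0 < radius φ l :=
  (radius_nonneg hcos l).lt_of_ne' (hLU.radius_ne_zero hn l hl1 hl)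

lemma IsLU.diag_zero (hn : 0 < n) (hLU : IsLU (V n α φ ψ) L U) :
    U ⟨0, hn⟩ ⟨0, hn⟩ = uDiag α φ ⟨0, hn⟩ := by
  have h := hLU.prod_diag hn 1 le_rfl hn
  rw [Fin.prod_univ_one, phaseArg_one, radius_one hn, mul_comm] at h
  exact h.trans (if_pos rfl).symm

lemma IsLU.diag_mul_prod_cos (hn : 0 < n) (hLU : IsLU (V n α φ ψ) L U) (l : Fin n)
    (hl : l.val ≠ 0) : U l l * ((∏ j : Fin l, Real.cos (φ l j) : ℝ) : ℂ) =
      Complex.exp (-(Complex.I * (α l : ℂ))) *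
        ((∏ k : {k : Fin n // l < k}, Real.cos (φ k.1 ⟨l, k.2⟩) : ℝ) : ℂ) := by
  have hl1 : 1 ≤ l.val := Nat.one_le_iff_ne_zero.2 hl
  set P : ℝ := ∏ j : Fin l, Real.cos (φ l j)
  set Q : ℝ := ∏ k : {k : Fin n // l < k}, Real.cos (φ k.1 ⟨l, k.2⟩)
  set E : ℂ := Complex.exp (Complex.I * (phaseArg hn α (l + 1) : ℂ)) with hE
  set F : ℂ := Complex.exp (Complex.I * (α l : ℂ))
  have hradius : (radius φ (l + 1) : ℂ) * P = radius φ l * Q :=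
    mod_cast radius_succ_mul_prod_cos φ l
  have hphase : Complex.exp (Complex.I * (phaseArg hn α l : ℂ)) =
      E * F := by
    rw [phaseArg_eq_phaseArg_succ_add hn α l, Complex.ofReal_add, mul_add, Complex.exp_add]
  have hquot : radius φ l * (E * F) * U l l = radius φ (l + 1) * E := by
    rw [← hphase, ← hLU.prod_diag hn l hl1 l.isLt.le, hE,
      ← hLU.prod_diag hn (l + 1) l.val.succ_pos l.isLt,
      Fin.prod_univ_castSucc]
    rfl
  have hinv : Complex.exp (-(Complex.I * (α l : ℂ))) * F = 1 := exp_neg_I_mul_mul_exp_I_mul _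
  have hne : (radius φ l : ℂ) * (E * F) ≠ 0 := mul_ne_zero
    (Complex.ofReal_ne_zero.2 (hLU.radius_ne_zero hn l hl1 l.isLt.le))
    (mul_ne_zero (Complex.exp_ne_zero _) (Complex.exp_ne_zero _))
  refine mul_left_cancel₀ hne ?_
  linear_combination P * hquot + E * hradius - radius φ l * E * Q * hinv

lemma IsLU.diag_eq (hn : 0 < n) (hLU : IsLU (V n α φ ψ) L U) (l : Fin n) :
    U l l = uDiag α φ l := by
  by_cases hl : l.val = 0
  · obtain rfl : l = ⟨0, hn⟩ := Fin.ext hl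
    exact hLU.diag_zero hn
  · have hcos := prod_cos_ne_zero_of_radius_ne_zero
      (hLU.radius_ne_zero hn l (Nat.one_le_iff_ne_zero.2 hl) l.isLt.le)
    rw [uDiag, if_neg hl, Complex.ofReal_div, mul_div_assoc', ← hLU.diag_mul_prod_cos hn l hl,
      mul_div_cancel_right₀ _ (Complex.ofReal_ne_zero.2 hcos)]

end LU

section Polar

lemma injOn_exp_neg_I_mul :
    Set.InjOn (fun θ : ℝ => Complex.exp (-(Complex.I * (θ : ℂ)))) (Set.Ico (-Real.pi) Real.pi) := by
  intro θ hθ θ' hθ' h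
  have him (x : ℝ) : (-(Complex.I * (x : ℂ))).im = -x := by simp
  have hinj := Complex.exp_inj_of_neg_pi_lt_of_le_pi (by rw [him]; linarith [hθ.2])
    (by rw [him]; linarith [hθ.1]) (by rw [him]; linarith [hθ'.2])
    (by rw [him]; linarith [hθ'.1]) h
  simpa using hinj

lemma exists_eq_norm_mul_exp_neg_I_mul (z : ℂ) : ∃ θ ∈ Set.Ico (-Real.pi) Real.pi,
    z = (‖z‖ : ℂ) * Complex.exp (-(Complex.I * (θ : ℂ))) := by
  refine ⟨-z.arg, ⟨neg_le_neg z.arg_le_pi, neg_lt.1 z.neg_pi_lt_arg⟩, ?_⟩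
  rw [Complex.ofReal_neg, mul_neg, neg_neg, mul_comm Complex.I, Complex.norm_mul_exp_arg_mul_I]

lemma eq_and_eq_of_mul_exp_neg_I_mul_eq {r r' θ θ' : ℝ} (hr : 0 < r) (hr' : 0 ≤ r')
    (hθ : θ ∈ Set.Ico (-Real.pi) Real.pi) (hθ' : θ' ∈ Set.Ico (-Real.pi) Real.pi)
    (h : (r : ℂ) * Complex.exp (-(Complex.I * (θ : ℂ))) =
      r' * Complex.exp (-(Complex.I * (θ' : ℂ)))) : r = r' ∧ θ = θ' := by
  have hrr : r = r' := by
    simpa only [norm_mul, norm_exp_neg_I_mul, mul_one, Complex.norm_real, Real.norm_of_nonneg,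
      hr.le, hr'] using congrArg norm h
  subst hrr
  exact ⟨rfl, injOn_exp_neg_I_mul hθ hθ' (mul_left_cancel₀ (Complex.ofReal_ne_zero.2 hr.ne') h)⟩

lemma exists_eq_sqrt_mul_cos_sin {x y : ℝ} (hx : 0 ≤ x) (hy : 0 ≤ y) :
    ∃ φ ∈ Set.Icc 0 (Real.pi / 2),
      x = √(x ^ 2 + y ^ 2) * Real.cos φ ∧ y = √(x ^ 2 + y ^ 2) * Real.sin φ := by
  let z : ℂ := ⟨x, y⟩
  have hz : √(x ^ 2 + y ^ 2) = ‖z‖ := Complex.norm_def z ▸ by simp [z, Complex.normSq_mk, sq]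
  refine ⟨z.arg, ⟨Complex.arg_nonneg_iff.2 hy, Complex.arg_le_pi_div_two_iff.2 (Or.inl hx)⟩, ?_, ?_⟩
  · rw [hz, Complex.norm_mul_cos_arg]
  · rw [hz, Complex.norm_mul_sin_arg]

end Polar

section Row

/-- The admissible ranges for the angles of the factors of one matrix `H_n`. -/
structure RowInRange {m : ℕ} (α : ℝ) (φ ψ : Fin m → ℝ) : Prop where
  alpha : α ∈ Set.Ico (-Real.pi) Real.pi
  phi : ∀ j, φ j ∈ Set.Icc 0 (Real.pi / 2)
  psi : ∀ j, ψ j ∈ Set.Ico (-Real.pi) Real.pi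

variable {m : ℕ}

lemma cosCoef_cons (α φ₀ : ℝ) (φ : Fin m → ℝ) : cosCoef α (Fin.cons φ₀ φ) =
    Fin.cons (Complex.exp (-(Complex.I * (α : ℂ))) * (Real.cos φ₀ : ℂ)) (cosCoef 0 φ) := by
  ext i
  cases i using Fin.cases <;> simp [cosCoef]

lemma sinCoef_cons (φ₀ ψ₀ : ℝ) (φ ψ : Fin m → ℝ) : sinCoef (Fin.cons φ₀ φ) (Fin.cons ψ₀ ψ) =
    Fin.cons (-(Complex.exp (-(Complex.I * (ψ₀ : ℂ))) * (Real.sin φ₀ : ℂ))) (sinCoef φ ψ) := by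
  ext i
  cases i using Fin.cases <;> rfl

lemma exists_sphericalVec_eq (d : ℕ) (w : Fin (d + 1) → ℂ)
    (hlast : w (Fin.last d) = (‖w (Fin.last d)‖ : ℂ)) : ∃ φ ψ : Fin d → ℝ, RowInRange 0 φ ψ ∧
      w = (√(∑ i, ‖w i‖ ^ 2) : ℂ) • sphericalVec d (cosCoef 0 φ) (sinCoef φ ψ) := by
  have hzero : (0 : ℝ) ∈ Set.Ico (-Real.pi) Real.pi := ⟨neg_nonpos.2 Real.pi_nonneg, Real.pi_pos⟩
  induction d with
  | zero =>
    refine ⟨0, 0, ⟨hzero, fun j => j.elim0, fun j => j.elim0⟩, ?_⟩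
    ext i
    rw [Fin.sum_univ_one, Real.sqrt_sq (norm_nonneg _), Subsingleton.elim (α := Fin 1) i 0]
    exact hlast.trans (mul_one _).symm
  | succ d ih =>
    obtain ⟨φ, ψ, hφψ, htail⟩ := ih (fun i => w i.succ) hlast
    obtain ⟨ψ₀, hψ₀, hhead⟩ := exists_eq_norm_mul_exp_neg_I_mul (-w 0)
    obtain ⟨φ₀, hφ₀, hcos, hsin⟩ := exists_eq_sqrt_mul_cos_sin
      (Real.sqrt_nonneg (∑ i : Fin (d + 1), ‖w i.succ‖ ^ 2)) (norm_nonneg (w 0))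
    have hsum : √(∑ i : Fin (d + 1), ‖w i.succ‖ ^ 2) ^ 2 + ‖w 0‖ ^ 2 = ∑ i, ‖w i‖ ^ 2 := by
      rw [Real.sq_sqrt (Finset.sum_nonneg fun _ _ => sq_nonneg _), add_comm,
        Fin.sum_univ_succ fun i => ‖w i‖ ^ 2]
    rw [hsum] at hcos hsin
    refine ⟨Fin.cons φ₀ φ, Fin.cons ψ₀ ψ,
      ⟨hzero, Fin.cases hφ₀ hφψ.phi, Fin.cases hψ₀ hφψ.psi⟩, ?_⟩
    rw [cosCoef_cons, sinCoef_cons, sphericalVec]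
    ext i
    cases i using Fin.cases with
    | zero =>
      rw [norm_neg, hsin] at hhead
      simp only [Pi.smul_apply, Fin.cons_zero, smul_eq_mul]
      push_cast at hhead ⊢
      linear_combination -hhead
    | succ i =>
      refine (congrFun htail i).trans ?_
      simp only [hcos, Pi.smul_apply, Fin.cons_zero, Fin.cons_succ, smul_eq_mul]
      simp [mul_assoc]

lemma prodH_last_eq_cons (α φ₀ ψ₀ : ℝ) (φ ψ : Fin m → ℝ) :
    prodH α (Fin.cons φ₀ φ : Fin (m + 1) → ℝ) (Fin.cons ψ₀ ψ) (Fin.last (m + 1)) = Fin.cons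
      (-(Complex.exp (-(Complex.I * (ψ₀ : ℂ))) * (Real.sin φ₀ : ℂ)))
      ((Complex.exp (-(Complex.I * (α : ℂ))) * (Real.cos φ₀ : ℂ)) •
        sphericalVec m (cosCoef 0 φ) (sinCoef φ ψ)) := by
  rw [prodH_last, cosCoef_cons, sinCoef_cons]
  rfl

lemma exists_prodH_last_eq (w : Fin (m + 2) → ℂ) (hw : ∑ i, ‖w i‖ ^ 2 = 1) :
    ∃ (α : ℝ) (φ ψ : Fin (m + 1) → ℝ),
      RowInRange α φ ψ ∧ prodH α φ ψ (Fin.last (m + 1)) = w := by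
  obtain ⟨α, hα, hlast⟩ := exists_eq_norm_mul_exp_neg_I_mul (w (Fin.last (m + 1)))
  -- Multiplying all entries but the first by `e^{iα}` makes the last one nonnegative.
  let w' : Fin (m + 2) → ℂ :=
    Fin.cons (w 0) fun i => Complex.exp (Complex.I * (α : ℂ)) * w i.succ
  have hw' : ∑ i, ‖w' i‖ ^ 2 = 1 := by
    rw [Fin.sum_univ_succ] at hw ⊢
    simpa only [w', Fin.cons_zero, Fin.cons_succ, norm_mul, norm_exp_I_mul, one_mul] using hw
  have hlast' : w' (Fin.last (m + 1)) = (‖w' (Fin.last (m + 1))‖ : ℂ) := by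
    simp only [← Fin.succ_last, w', Fin.cons_succ, norm_mul, norm_exp_I_mul, one_mul] at hlast ⊢
    linear_combination Complex.exp (Complex.I * (α : ℂ)) * hlast +
      (‖w (Fin.last m).succ‖ : ℂ) * exp_neg_I_mul_mul_exp_I_mul α
  obtain ⟨φ, ψ, hφψ, h⟩ := exists_sphericalVec_eq (m + 1) w' hlast'
  refine ⟨α, φ, ψ, ⟨hα, hφψ.phi, hφψ.psi⟩, ?_⟩
  rw [hw', Real.sqrt_one, Complex.ofReal_one, one_smul] at h
  cases φ using Fin.consCases with | cons φ₀ φ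
  cases ψ using Fin.consCases with | cons ψ₀ ψ
  rw [cosCoef_cons, sinCoef_cons, sphericalVec] at h
  rw [prodH_last_eq_cons]
  ext i
  cases i using Fin.cases with
  | zero => exact (congrFun h 0).symm
  | succ i =>
    have hi := congrFun h i.succ
    simp only [w', Fin.cons_zero, Fin.cons_succ, Pi.smul_apply, smul_eq_mul, Complex.ofReal_zero,
      mul_zero, neg_zero, Complex.exp_zero, one_mul] at hi ⊢
    rw [mul_assoc, ← hi, ← mul_assoc, exp_neg_I_mul_mul_exp_I_mul, one_mul]

lemma sphericalVec_sin_injective {d : ℕ} {k k' t t' : Fin d → ℂ} (hk : ∀ j, k j ≠ 0)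
    (hkt : ∀ j, t j = t' j → k j = k' j) (h : sphericalVec d k t = sphericalVec d k' t') :
    t = t' := by
  induction d with
  | zero => exact Subsingleton.elim _ _
  | succ d ih =>
    obtain ⟨hhead, htail⟩ := Fin.cons_inj.1 h
    rw [← hkt 0 hhead] at htail
    have hsucc :=
      ih (fun j => hk j.succ) (fun j => hkt j.succ) (smul_right_injective _ (hk 0) htail)
    exact funext (Fin.cases hhead (congrFun hsucc))

lemma eq_and_eq_of_sinCoef_eq {φ ψ φ' ψ' : Fin m → ℝ} {j : Fin m}
    (hφ : φ j ∈ Set.Ioo 0 (Real.pi / 2)) (hφ' : φ' j ∈ Set.Icc 0 (Real.pi / 2))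
    (hψ : ψ j ∈ Set.Ico (-Real.pi) Real.pi) (hψ' : ψ' j ∈ Set.Ico (-Real.pi) Real.pi)
    (h : sinCoef φ ψ j = sinCoef φ' ψ' j) : φ j = φ' j ∧ ψ j = ψ' j := by
  have hpos : 0 < Real.sin (φ j) :=
    Real.sin_pos_of_pos_of_lt_pi hφ.1 (hφ.2.trans (half_lt_self Real.pi_pos))
  have hnonneg : 0 ≤ Real.sin (φ' j) :=
    Real.sin_nonneg_of_nonneg_of_le_pi hφ'.1 (hφ'.2.trans (half_le_self Real.pi_nonneg))
  rw [sinCoef, sinCoef, neg_inj, mul_comm, mul_comm _ (Real.sin (φ' j) : ℂ)] at h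
  obtain ⟨hsin, hψψ⟩ := eq_and_eq_of_mul_exp_neg_I_mul_eq hpos hnonneg hψ hψ' h
  have hpi : -(Real.pi / 2) ≤ 0 := by linarith [Real.pi_pos]
  exact ⟨Real.injOn_sin ⟨hpi.trans hφ.1.le, hφ.2.le⟩ ⟨hpi.trans hφ'.1, hφ'.2⟩ hsin, hψψ⟩

lemma prod_cosCoef (α : ℝ) (φ : Fin (m + 1) → ℝ) : ∏ j, cosCoef α φ j =
    ((∏ j, Real.cos (φ j) : ℝ) : ℂ) * Complex.exp (-(Complex.I * (α : ℂ))) := by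
  have h := congrArg star (prod_star_cosCoef α φ (m + 1) m.succ_pos le_rfl)
  rw [star_prod, star_mul, star_exp_I_mul, Complex.star_def, Complex.conj_ofReal] at h
  simpa only [Fin.castLE_rfl, id, Complex.star_def, Complex.conj_conj] using h

lemma eq_of_prodH_last_eq {α α' : ℝ} {φ ψ φ' ψ' : Fin (m + 1) → ℝ} (h : RowInRange α φ ψ)
    (h' : RowInRange α' φ' ψ') (hφ : ∀ j, φ j ∈ Set.Ioo 0 (Real.pi / 2))
    (heq : prodH α φ ψ (Fin.last (m + 1)) = prodH α' φ' ψ' (Fin.last (m + 1))) :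
    α = α' ∧ φ = φ' ∧ ψ = ψ' := by
  have hpi : -(Real.pi / 2) ≤ 0 := by linarith [Real.pi_pos]
  have hcos (j) : 0 < Real.cos (φ j) :=
    Real.cos_pos_of_mem_Ioo ⟨hpi.trans_lt (hφ j).1, (hφ j).2⟩
  have hcos' (j) : 0 ≤ Real.cos (φ' j) :=
    Real.cos_nonneg_of_mem_Icc ⟨hpi.trans (h'.phi j).1, (h'.phi j).2⟩
  rw [prodH_last, prodH_last] at heq
  have hlast := congrFun heq (Fin.last _)
  rw [sphericalVec_last, sphericalVec_last, prod_cosCoef, prod_cosCoef] at hlast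
  obtain ⟨-, rfl⟩ := eq_and_eq_of_mul_exp_neg_I_mul_eq (Finset.prod_pos fun j _ => hcos j)
    (Finset.prod_nonneg fun j _ => hcos' j) h.alpha h'.alpha hlast
  have hangles (j) (hj : sinCoef φ ψ j = sinCoef φ' ψ' j) : φ j = φ' j ∧ ψ j = ψ' j :=
    eq_and_eq_of_sinCoef_eq (hφ j) (h'.phi j) (h.psi j) (h'.psi j) hj
  have hsin : sinCoef φ ψ = sinCoef φ' ψ' := by
    refine sphericalVec_sin_injective (fun j => ?_) (fun j hj => ?_) heq
    · exact mul_ne_zero (Complex.exp_ne_zero _) (Complex.ofReal_ne_zero.2 (hcos j).ne')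
    · rw [cosCoef, cosCoef, (hangles j hj).1]
  exact ⟨rfl, funext fun j => (hangles j (congrFun hsin j)).1,
    funext fun j => (hangles j (congrFun hsin j)).2⟩

end Row

section Coordinates

lemma ofReal_sum_norm_sq {d : ℕ} (v : Fin d → ℂ) :
    ((∑ i, ‖v i‖ ^ 2 : ℝ) : ℂ) = v ⬝ᵥ star v := by
  push_cast
  refine Finset.sum_congr rfl fun i _ => ?_
  rw [Pi.star_apply, Complex.star_def, Complex.mul_conj, Complex.normSq_eq_norm_sq]
  push_cast
  rfl

lemma sum_norm_sq_row {n : ℕ} {W : Matrix (Fin n) (Fin n) ℂ} (hW : W ∈ unitaryGroup (Fin n) ℂ)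
    (i : Fin n) : ∑ j, ‖W i j‖ ^ 2 = 1 := by
  have h : (∑ j, ‖W i j‖ ^ 2 : ℝ) = (1 : ℂ) := by
    rw [ofReal_sum_norm_sq, ← one_apply_eq i, ← mem_unitaryGroup_iff.1 hW]
    rfl
  exact mod_cast h

lemma exists_eq_diagOne_mul {m : ℕ} {W H : Matrix (Fin (m + 1)) (Fin (m + 1)) ℂ}
    (hW : W ∈ unitaryGroup (Fin (m + 1)) ℂ) (hH : H ∈ unitaryGroup (Fin (m + 1)) ℂ)
    (h : H (Fin.last m) = W (Fin.last m)) :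
    ∃ A ∈ unitaryGroup (Fin m) ℂ, W = diagOne A * H := by
  have hlast : (W * star H) (Fin.last m) = Pi.single (Fin.last m) 1 := calc
    (W * star H) (Fin.last m) = (H * star H) (Fin.last m) := by
      ext s
      rw [Matrix.mul_apply, Matrix.mul_apply, h]
    _ = Pi.single (Fin.last m) 1 := by
      rw [mem_unitaryGroup_iff.1 hH]
      exact funext fun s => one_eq_pi_single
  obtain ⟨A, hA, hWA⟩ := exists_eq_diagOne (mul_mem hW (Unitary.star_mem hH)) hlast
  exact ⟨A, hA, by rw [← hWA, mul_assoc, mem_unitaryGroup_iff'.1 hH, mul_one]⟩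

namespace InRange

variable {n : ℕ} {α : Fin (n + 1) → ℝ} {φ ψ : PairAngles (n + 1)}

lemma init (h : InRange α φ ψ) : InRange (fun k : Fin n => α k.castSucc)
    (fun k : Fin n => φ k.castSucc) (fun k : Fin n => ψ k.castSucc) :=
  ⟨fun _ => h.alpha _, fun k => h.phi k.castSucc, fun k => h.psi k.castSucc⟩

lemma last (h : InRange α φ ψ) : RowInRange (m := n) (α (Fin.last n)) (φ (Fin.last n))
    (ψ (Fin.last n)) :=
  ⟨h.alpha _, h.phi (Fin.last n), h.psi (Fin.last n)⟩

lemma snoc {α : Fin n → ℝ} {φ ψ : PairAngles n} (h : InRange α φ ψ) {a : ℝ} {x y : Fin n → ℝ}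
    (hrow : RowInRange a x y) :
    InRange (Fin.snoc (α := fun _ => ℝ) α a) (Fin.snoc (α := fun k : Fin (n + 1) => Fin k → ℝ) φ x)
      (Fin.snoc (α := fun k : Fin (n + 1) => Fin k → ℝ) ψ y) where
  alpha k := by cases k using Fin.lastCases <;> simp [h.alpha, hrow.alpha]
  phi k := by
    cases k using Fin.lastCases with
    | last => rw [Fin.snoc_last]; exact hrow.phi
    | cast k => rw [Fin.snoc_castSucc]; exact h.phi k
  psi k := by
    cases k using Fin.lastCases with
    | last => rw [Fin.snoc_last]; exact hrow.psi
    | cast k => rw [Fin.snoc_castSucc]; exact h.psi k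

end InRange

instance subsingleton_pairAngles_one : Subsingleton (PairAngles 1) :=
  ⟨fun _ _ => funext fun k => funext fun j => absurd j.isLt (by omega)⟩

lemma exists_V_one_eq {W : Matrix (Fin 1) (Fin 1) ℂ} (hW : W ∈ unitaryGroup (Fin 1) ℂ) :
    ∃ (α : Fin 1 → ℝ) (φ ψ : PairAngles 1), InRange α φ ψ ∧ V 1 α φ ψ = W := by
  obtain ⟨α, hα, h⟩ := exists_eq_norm_mul_exp_neg_I_mul (star (W 0 0))
  have hnorm : ‖W 0 0‖ = 1 := by
    simpa only [Fin.sum_univ_one, pow_eq_one_iff_of_nonneg (norm_nonneg _) two_ne_zero] using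
      sum_norm_sq_row hW 0
  rw [norm_star, hnorm, Complex.ofReal_one, one_mul, ← star_exp_I_mul, star_inj] at h
  have hempty (k : Fin 1) (j : Fin k) : False := absurd j.isLt (by omega)
  refine ⟨fun _ => α, 0, 0, ⟨fun _ => hα, fun k j => (hempty k j).elim,
    fun k j => (hempty k j).elim⟩, ?_⟩
  ext i j
  rw [Subsingleton.elim (α := Fin 1) i 0, Subsingleton.elim (α := Fin 1) j 0, h]
  rfl

theorem exists_V_eq (n : ℕ) {W : Matrix (Fin n) (Fin n) ℂ} (hW : W ∈ unitaryGroup (Fin n) ℂ) :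
    ∃ (α : Fin n → ℝ) (φ ψ : PairAngles n), InRange α φ ψ ∧ V n α φ ψ = W := by
  match n, W, hW with
  | 0, _, _ => exact ⟨0, 0, 0, ⟨fun k => k.elim0, fun k => k.elim0, fun k => k.elim0⟩,
      Subsingleton.elim _ _⟩
  | 1, _, hW => exact exists_V_one_eq hW
  | m + 2, W, hW =>
    obtain ⟨a, x, y, hrow, hlast⟩ :=
      exists_prodH_last_eq (W (Fin.last (m + 1))) (sum_norm_sq_row hW _)
    obtain ⟨A, hA, rfl⟩ := exists_eq_diagOne_mul hW (prodH_mem_unitaryGroup a x y) hlast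
    obtain ⟨α, φ, ψ, hrange, rfl⟩ := exists_V_eq (m + 1) hA
    refine ⟨_, _, _, hrange.snoc hrow, ?_⟩
    rw [V]
    simp only [Fin.snoc_last, Fin.snoc_castSucc]

theorem eq_of_V_eq (n : ℕ) {α α' : Fin n → ℝ} {φ ψ φ' ψ' : PairAngles n} (h : InRange α φ ψ)
    (h' : InRange α' φ' ψ') (hφ : ∀ k j, φ k j ∈ Set.Ioo 0 (Real.pi / 2))
    (heq : V n α φ ψ = V n α' φ' ψ') : α = α' ∧ φ = φ' ∧ ψ = ψ' := by
  match n with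
  | 0 => exact ⟨Subsingleton.elim _ _, Subsingleton.elim _ _, Subsingleton.elim _ _⟩
  | 1 =>
    have hexp := congrArg star (congrFun (congrFun heq 0) 0)
    simp only [V, of_apply, star_exp_I_mul] at hexp
    have hα := injOn_exp_neg_I_mul (h.alpha 0) (h'.alpha 0) hexp
    exact ⟨funext (Fin.forall_fin_one.2 hα), Subsingleton.elim _ _, Subsingleton.elim _ _⟩
  | m + 2 =>
    rw [V, V] at heq
    have hlast := congrFun heq (Fin.last (m + 1))
    rw [diagOne_mul_last, diagOne_mul_last] at hlast
    obtain ⟨hα, hφφ, hψψ⟩ := eq_of_prodH_last_eq h.last h'.last (hφ (Fin.last (m + 1))) hlast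
    rw [hα, hφφ, hψψ] at heq
    have hH : IsUnit (prodH (α' (Fin.last (m + 1))) (φ' (Fin.last (m + 1)))
        (ψ' (Fin.last (m + 1)))) :=
      (Unitary.toUnits ⟨_, prodH_mem_unitaryGroup (m := m + 1) _ _ _⟩).isUnit
    obtain ⟨hαs, hφs, hψs⟩ := eq_of_V_eq (m + 1) h.init h'.init (fun k => hφ k.castSucc)
      (diagOne_injective (hH.mul_right_cancel heq))
    exact ⟨funext (Fin.lastCases hα (congrFun hαs)), funext (Fin.lastCases hφφ (congrFun hφs)),
      funext (Fin.lastCases hψψ (congrFun hψs))⟩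

end Coordinates

section OneDimensionalMeasures

instance isProbabilityMeasure_angleMeasure : IsProbabilityMeasure angleMeasure := by
  constructor
  rw [angleMeasure, Measure.smul_apply, Measure.restrict_apply_univ, Real.volume_Ico, smul_eq_mul,
    ← ENNReal.ofReal_mul (by positivity)]
  rw [show 1 / (2 * Real.pi) * (Real.pi - -Real.pi) = 1 by field_simp; ring, ENNReal.ofReal_one]

lemma integral_cos_pow_mul_sin_zero_pi_div_two (m : ℕ) :
    ∫ x in (0 : ℝ)..(Real.pi / 2), ((m : ℝ) + 1) * Real.cos x ^ m * Real.sin x = 1 := by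
  have hderiv (x : ℝ) : HasDerivAt (fun x => -Real.cos x ^ (m + 1))
      (((m : ℝ) + 1) * Real.cos x ^ m * Real.sin x) x := by
    convert! ((Real.hasDerivAt_cos x).pow (m + 1)).neg using 1
    push_cast
    ring
  rw [intervalIntegral.integral_eq_sub_of_hasDerivAt (fun x _ => hderiv x)
    (Continuous.intervalIntegrable (by fun_prop) _ _)]
  simp

lemma phiMeasure_succ_eq_withDensity (d : ℕ) :
    phiMeasure (d + 1) = (volume.restrict (Set.Ioo 0 (Real.pi / 2))).withDensity fun x =>
      ENNReal.ofReal (((2 * d + 1 : ℕ) + 1) * Real.cos x ^ (2 * d + 1) * Real.sin x) := by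
  rw [phiMeasure, Measure.restrict_congr_set Ioo_ae_eq_Icc.symm]
  congr! 5
  push_cast
  ring

instance isProbabilityMeasure_phiMeasure (d : ℕ) : IsProbabilityMeasure (phiMeasure (d + 1)) := by
  constructor
  rw [phiMeasure_succ_eq_withDensity, withDensity_apply _ MeasurableSet.univ, Measure.restrict_univ,
    ← ofReal_integral_eq_lintegral_ofReal, ← integral_Ioc_eq_integral_Ioo,
    ← intervalIntegral.integral_of_le (by positivity), integral_cos_pow_mul_sin_zero_pi_div_two,
    ENNReal.ofReal_one]
  · exact (Continuous.integrableOn_Icc (by fun_prop)).mono_set Set.Ioo_subset_Icc_self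
  · filter_upwards [ae_restrict_mem measurableSet_Ioo] with x hx
    have hcos := Real.cos_pos_of_mem_Ioo ⟨by linarith [hx.1, Real.pi_pos], hx.2⟩
    have hsin := Real.sin_pos_of_pos_of_lt_pi hx.1 (by linarith [hx.2, Real.pi_pos])
    simp only [Pi.zero_apply]
    positivity

/-- The uniform probability measure on the unit circle, as a measure on `ℂ`. -/
def circleMeasure : Measure ℂ :=
  angleMeasure.map fun θ : ℝ => Complex.exp (Complex.I * (θ : ℂ))

instance isProbabilityMeasure_circleMeasure : IsProbabilityMeasure circleMeasure :=
  Measure.isProbabilityMeasure_map (by fun_prop)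

lemma norm_eq_one_ae_circleMeasure : ∀ᵐ u ∂circleMeasure, ‖u‖ = 1 := by
  rw [circleMeasure, ae_map_iff (by fun_prop)
    (measurableSet_eq_fun measurable_norm measurable_const)]
  exact ae_of_all _ norm_exp_I_mul

lemma measurePreserving_exp_I_mul :
    MeasurePreserving (fun θ : ℝ => Complex.exp (Complex.I * (θ : ℂ))) angleMeasure circleMeasure :=
  ⟨by fun_prop, rfl⟩

/-- The distribution of the radius under Lebesgue measure on `ℂ^{d+1}`. The constant
`2 π^{d+1} / d!` is the area of the unit sphere. -/
def radialMeasure (d : ℕ) : Measure ℝ :=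
  (volume.restrict (Set.Ioi 0)).withDensity fun r =>
    ENNReal.ofReal (2 * Real.pi ^ (d + 1) / d.factorial * r ^ (2 * d + 1))

instance sFinite_radialMeasure (d : ℕ) : SFinite (radialMeasure d) := by
  unfold radialMeasure
  infer_instance

lemma radialMeasure_zero : radialMeasure 0 = (volume.restrict (Set.Ioi 0)).withDensity fun r =>
    ENNReal.ofReal (2 * Real.pi * r) := by
  simp [radialMeasure]

lemma pos_ae_radialMeasure (d : ℕ) : ∀ᵐ r ∂radialMeasure d, 0 < r :=
  (withDensity_absolutelyContinuous _ _).ae_le (ae_restrict_mem measurableSet_Ioi)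

lemma radialMeasure_Iic_one_ne_zero (d : ℕ) : radialMeasure d (Set.Iic 1) ≠ 0 := by
  rw [radialMeasure, withDensity_apply _ measurableSet_Iic, Measure.restrict_restrict
    measurableSet_Iic, Set.inter_comm, Set.Ioi_inter_Iic]
  refine (setLIntegral_pos_iff (by fun_prop)).2 ?_ |>.ne'
  refine lt_of_lt_of_le ?_ (measure_mono (s := Set.Ioc (0 : ℝ) 1) fun r hr => ⟨?_, hr⟩)
  · simp
  · have := hr.1
    have := Real.pi_pos
    simp only [Function.mem_support, ne_eq, ENNReal.ofReal_eq_zero, not_le]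
    positivity

lemma radialMeasure_Iic_one_ne_top (d : ℕ) : radialMeasure d (Set.Iic 1) ≠ ∞ := by
  rw [radialMeasure, withDensity_apply _ measurableSet_Iic, Measure.restrict_restrict
    measurableSet_Iic, Set.inter_comm, Set.Ioi_inter_Iic]
  have hint : IntegrableOn (fun r : ℝ => 2 * Real.pi ^ (d + 1) / d.factorial * r ^ (2 * d + 1))
      (Set.Ioc 0 1) :=
    (Continuous.integrableOn_Icc (by fun_prop)).mono_set Set.Ioc_subset_Icc_self
  exact hint.lintegral_lt_top.ne

end OneDimensionalMeasures

section PlanePolarCoordinates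

lemma setLIntegral_comp_polarCoord_symm {s : Set (ℝ × ℝ)} (hs : MeasurableSet s)
    (f : ℝ × ℝ → ℝ≥0∞) :
    ∫⁻ p in polarCoord.symm ⁻¹' s ∩ polarCoord.target,
      ENNReal.ofReal p.1 * f (polarCoord.symm p) = ∫⁻ p in s, f p := by
  rw [← lintegral_indicator hs, ← lintegral_comp_polarCoord_symm,
    ← setLIntegral_indicator (continuous_polarCoord_symm.measurable hs)]
  refine lintegral_congr fun p => ?_
  by_cases hp : polarCoord.symm p ∈ s
  · rw [Set.indicator_of_mem (show p ∈ polarCoord.symm ⁻¹' s from hp), Set.indicator_of_mem hp,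
      smul_eq_mul]
  · rw [Set.indicator_of_notMem (show p ∉ polarCoord.symm ⁻¹' s from hp),
      Set.indicator_of_notMem hp, smul_zero]

lemma polarCoord_symm_preimage_quadrant :
    polarCoord.symm ⁻¹' (Set.Ioi 0 ×ˢ Set.Ioi 0) ∩ polarCoord.target =
      Set.Ioi 0 ×ˢ Set.Ioo 0 (Real.pi / 2) := by
  have := Real.pi_pos
  ext ⟨r, x⟩
  simp only [polarCoord_target, Set.mem_inter_iff, Set.mem_preimage, polarCoord_symm_apply,
    Set.mem_prod, Set.mem_Ioi, Set.mem_Ioo]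
  constructor
  · rintro ⟨⟨hc, hs⟩, hr, hx₁, hx₂⟩
    refine ⟨hr, ?_, ?_⟩
    · by_contra! h
      exact (mul_nonpos_of_nonneg_of_nonpos hr.le
        (Real.sin_nonpos_of_nonpos_of_neg_pi_le h hx₁.le)).not_gt hs
    · by_contra! h
      exact (mul_nonpos_of_nonneg_of_nonpos hr.le
        (Real.cos_nonpos_of_pi_div_two_le_of_le h (by linarith))).not_gt hc
  · rintro ⟨hr, h₀, h₁⟩
    exact ⟨⟨mul_pos hr (Real.cos_pos_of_mem_Ioo ⟨by linarith, h₁⟩),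
      mul_pos hr (Real.sin_pos_of_pos_of_lt_pi h₀ (by linarith))⟩, hr, by linarith, by linarith⟩

lemma measurePreserving_quadrant_polar (d : ℕ) :
    MeasurePreserving (fun p : ℝ × ℝ => (p.1 * Real.cos p.2, p.1 * Real.sin p.2))
      ((radialMeasure (d + 1)).prod (phiMeasure (d + 1)))
      ((radialMeasure d).prod (radialMeasure 0)) := by
  refine ⟨by fun_prop, Measure.ext_of_lintegral _ fun f hf => ?_⟩
  rw [lintegral_map hf (by fun_prop), phiMeasure_succ_eq_withDensity, radialMeasure_zero,
    radialMeasure, radialMeasure, prod_withDensity (by fun_prop) (by fun_prop),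
    prod_withDensity (by fun_prop) (by fun_prop), Measure.prod_restrict, Measure.prod_restrict,
    ← Measure.volume_eq_prod,
    lintegral_withDensity_eq_lintegral_mul _ (by fun_prop) (by fun_prop),
    lintegral_withDensity_eq_lintegral_mul _ (by fun_prop) hf,
    ← setLIntegral_comp_polarCoord_symm (measurableSet_Ioi.prod measurableSet_Ioi),
    polarCoord_symm_preimage_quadrant]
  refine setLIntegral_congr_fun (measurableSet_Ioi.prod measurableSet_Ioo) fun p hp => ?_
  obtain ⟨r, x⟩ := p
  have hr : 0 < r := hp.1
  have hx : 0 < x ∧ x < Real.pi / 2 := hp.2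
  have hcos := Real.cos_pos_of_mem_Ioo ⟨by linarith [hx.1, Real.pi_pos], hx.2⟩
  simp only [Pi.mul_apply, polarCoord_symm_apply]
  rw [← ENNReal.ofReal_mul (by positivity), ← ENNReal.ofReal_mul (by positivity),
    ← mul_assoc (ENNReal.ofReal r), ← ENNReal.ofReal_mul hr.le]
  congr 2
  rw [Nat.factorial_succ]
  push_cast
  field_simp
  ring

lemma measurePreserving_circle_polar :
    MeasurePreserving (fun p : ℝ × ℂ => p.1 • p.2) ((radialMeasure 0).prod circleMeasure)
      volume := by
  refine ⟨by fun_prop, Measure.ext_of_lintegral _ fun f hf => ?_⟩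
  rw [lintegral_map hf (by fun_prop),
    ← ((MeasurePreserving.id (radialMeasure 0)).prod measurePreserving_exp_I_mul).lintegral_comp
      (by fun_prop),
    radialMeasure_zero, angleMeasure, Measure.restrict_congr_set Ioo_ae_eq_Ico.symm,
    Measure.prod_smul_right, prod_withDensity_left (by fun_prop), Measure.prod_restrict,
    ← Measure.volume_eq_prod, ← Complex.lintegral_comp_polarCoord_symm, polarCoord_target,
    lintegral_smul_measure, lintegral_withDensity_eq_lintegral_mul _ (by fun_prop) (by fun_prop),
    smul_eq_mul, ← lintegral_const_mul _ (by fun_prop)]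
  refine setLIntegral_congr_fun (measurableSet_Ioi.prod measurableSet_Ioo) fun p hp => ?_
  obtain ⟨r, θ⟩ := p
  simp only [Pi.mul_apply, Prod.map_apply, id_eq, smul_eq_mul]
  rw [← mul_assoc, ← ENNReal.ofReal_mul (by positivity), Complex.polarCoord_symm_apply,
    mul_comm Complex.I, Complex.exp_mul_I, Complex.real_smul, Complex.ofReal_cos,
    Complex.ofReal_sin]
  congr 2
  field_simp

end PlanePolarCoordinates

section ProductMeasures

lemma measurePreserving_of_comp {X Y Z : Type*} [MeasurableSpace X] [MeasurableSpace Y]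
    [MeasurableSpace Z] {μ : Measure X} {ν : Measure Y} {ρ : Measure Z} {f : X → Y} {g : Y → Z}
    (hf : MeasurePreserving f μ ν) (hg : Measurable g) (hgf : MeasurePreserving (g ∘ f) μ ρ) :
    MeasurePreserving g ν ρ :=
  hf.map_eq ▸ hgf.map_of_comp hg hf.measurable

lemma measurePreserving_prodLeftComm {X Y Z : Type*} [MeasurableSpace X] [MeasurableSpace Y]
    [MeasurableSpace Z] (μ : Measure X) (ν : Measure Y) (ρ : Measure Z) [SFinite μ] [SFinite ν]
    [SFinite ρ] :
    MeasurePreserving (fun p : X × Y × Z => (p.2.1, p.1, p.2.2)) (μ.prod (ν.prod ρ))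
      (ν.prod (μ.prod ρ)) :=
  (measurePreserving_prodAssoc ν μ ρ).comp <|
    (Measure.measurePreserving_swap.prod (MeasurePreserving.id ρ)).comp <|
      (measurePreserving_prodAssoc μ ν ρ).symm

lemma measurePreserving_prodProdProdComm {X₁ X₂ Y₁ Y₂ : Type*} [MeasurableSpace X₁]
    [MeasurableSpace X₂] [MeasurableSpace Y₁] [MeasurableSpace Y₂] (μ₁ : Measure X₁)
    (μ₂ : Measure X₂) (ν₁ : Measure Y₁) (ν₂ : Measure Y₂) [SFinite μ₁] [SFinite μ₂] [SFinite ν₁]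
    [SFinite ν₂] :
    MeasurePreserving (Equiv.prodProdProdComm X₁ X₂ Y₁ Y₂) ((μ₁.prod μ₂).prod (ν₁.prod ν₂))
      ((μ₁.prod ν₁).prod (μ₂.prod ν₂)) :=
  (measurePreserving_prodAssoc μ₁ ν₁ (μ₂.prod ν₂)).symm.comp <|
    ((MeasurePreserving.id μ₁).prod (measurePreserving_prodLeftComm μ₂ ν₁ ν₂)).comp <|
      measurePreserving_prodAssoc μ₁ μ₂ (ν₁.prod ν₂)

lemma measurePreserving_finCons {d : ℕ} {X : Fin (d + 1) → Type*} [∀ i, MeasurableSpace (X i)]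
    (μ : ∀ i, Measure (X i)) [∀ i, SigmaFinite (μ i)] :
    MeasurePreserving (fun p => (Fin.cons p.1 p.2 : ∀ i, X i))
      ((μ 0).prod (Measure.pi fun i => μ i.succ)) (Measure.pi μ) := by
  have hcons : (fun p : X 0 × (∀ i : Fin d, X i.succ) => (Fin.cons p.1 p.2 : ∀ i, X i)) =
      (MeasurableEquiv.piFinSuccAbove X 0).symm :=
    funext fun p => (Fin.insertNth_zero p.1 p.2).symm
  rw [hcons]
  exact (measurePreserving_piFinSuccAbove μ 0).symm

end ProductMeasures

section Sphere

/-- The uniform probability measure on the unit sphere of `ℂ^{d+1}`, in the recursive coordinates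
`(u sin φ, x cos φ)` with `u` on the unit circle and `x` on the unit sphere of `ℂ^d`. -/
def sphereMeasure : (d : ℕ) → Measure (Fin (d + 1) → ℂ)
  | 0 => circleMeasure.map fun u _ => u
  | d + 1 => ((phiMeasure (d + 1)).prod ((sphereMeasure d).prod circleMeasure)).map fun p =>
      Fin.cons (Real.sin p.1 • p.2.2) (Real.cos p.1 • p.2.1)

instance isProbabilityMeasure_sphereMeasure (d : ℕ) : IsProbabilityMeasure (sphereMeasure d) := by
  induction d with
  | zero => exact Measure.isProbabilityMeasure_map (by fun_prop)
  | succ d ih => exact Measure.isProbabilityMeasure_map (by fun_prop)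

lemma measurePreserving_const_sphereMeasure_zero :
    MeasurePreserving (fun (u : ℂ) (_ : Fin 1) => u) circleMeasure (sphereMeasure 0) :=
  ⟨by fun_prop, rfl⟩

lemma measurePreserving_cons_sphereMeasure_succ (d : ℕ) :
    MeasurePreserving (fun p : ℝ × (Fin (d + 1) → ℂ) × ℂ =>
        (Fin.cons (Real.sin p.1 • p.2.2) (Real.cos p.1 • p.2.1) : Fin (d + 2) → ℂ))
      ((phiMeasure (d + 1)).prod ((sphereMeasure d).prod circleMeasure))
      (sphereMeasure (d + 1)) :=
  ⟨by fun_prop, rfl⟩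

lemma smul_cons_smul_smul {d : ℕ} (r s c : ℝ) (u : ℂ) (x : Fin d → ℂ) :
    r • (Fin.cons (s • u) (c • x) : Fin (d + 1) → ℂ) = Fin.cons ((r * s) • u) ((r * c) • x) := by
  ext i
  cases i using Fin.cases <;> simp [mul_assoc]

lemma measurePreserving_sphere_polar (d : ℕ) :
    MeasurePreserving (fun p : ℝ × (Fin (d + 1) → ℂ) => p.1 • p.2)
      ((radialMeasure d).prod (sphereMeasure d)) volume := by
  induction d with
  | zero =>
    refine measurePreserving_of_comp
      ((MeasurePreserving.id _).prod measurePreserving_const_sphereMeasure_zero) (by fun_prop) ?_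
    exact (volume_preserving_funUnique (Fin 1) ℂ).symm.comp measurePreserving_circle_polar
  | succ d ih =>
    have hblocks := (ih.prod measurePreserving_circle_polar).comp <|
      (measurePreserving_prodProdProdComm (radialMeasure d) (radialMeasure 0) (sphereMeasure d)
        circleMeasure).comp <|
      ((measurePreserving_quadrant_polar d).prod (MeasurePreserving.id _)).comp <|
      (measurePreserving_prodAssoc (radialMeasure (d + 1)) (phiMeasure (d + 1))
        ((sphereMeasure d).prod circleMeasure)).symm
    refine measurePreserving_of_comp ((MeasurePreserving.id _).prod
      (measurePreserving_cons_sphereMeasure_succ d)) (by fun_prop) ?_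
    have hcons : MeasurePreserving (fun p : (Fin (d + 1) → ℂ) × ℂ =>
        (Fin.cons p.2 p.1 : Fin (d + 2) → ℂ)) :=
      (measurePreserving_finCons fun _ : Fin (d + 2) => (volume : Measure ℂ)).comp
        Measure.measurePreserving_swap
    exact (hcons.comp hblocks).congr (by fun_prop) <| ae_of_all _ fun p =>
      (smul_cons_smul_smul p.1 _ _ p.2.2.2 p.2.2.1).symm

end Sphere

section AngularPart

variable {E : Type*} [AddCommGroup E] [Module ℝ E] [MeasurableSpace E] [MeasurableSMul₂ ℝ E]
  {ρ : Measure ℝ} {σ ν : Measure E} [SFinite σ] {N : E → ℝ}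

lemma measure_cone_of_polar (hpolar : MeasurePreserving (fun p : ℝ × E => p.1 • p.2) (ρ.prod σ) ν)
    (hρ : ∀ᵐ r ∂ρ, 0 < r) (hN : Measurable N) (hN₁ : ∀ᵐ x ∂σ, N x = 1)
    (hNr : ∀ r : ℝ, 0 < r → ∀ x, N (r • x) = r * N x) {A : Set E} (hA : MeasurableSet A) :
    ν {z | N z ≤ 1 ∧ (N z)⁻¹ • z ∈ A} = ρ (Set.Iic 1) * σ A := by
  have hmeas : MeasurableSet {z | N z ≤ 1 ∧ (N z)⁻¹ • z ∈ A} :=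
    (measurableSet_le hN measurable_const).inter ((hN.inv.smul measurable_id) hA)
  rw [← hpolar.measure_preimage hmeas.nullMeasurableSet, ← Measure.prod_prod]
  refine measure_congr ?_
  filter_upwards [Measure.quasiMeasurePreserving_fst.ae hρ,
    Measure.quasiMeasurePreserving_snd.ae hN₁] with p hp₁ hp₂
  have hNp : N (p.1 • p.2) = p.1 := by rw [hNr _ hp₁, hp₂, mul_one]
  refine propext ?_
  change N (p.1 • p.2) ≤ 1 ∧ (N (p.1 • p.2))⁻¹ • p.1 • p.2 ∈ A ↔ p.1 ≤ 1 ∧ p.2 ∈ A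
  rw [hNp, inv_smul_smul₀ (ne_of_gt hp₁)]

/-- If `ν` disintegrates into a radial part `ρ` and an angular part `σ` on the unit sphere of a
positively homogeneous function `N`, then the symmetries of `ν` and `N` preserve `σ`. -/
lemma measurePreserving_angular_of_polar
    (hpolar : MeasurePreserving (fun p : ℝ × E => p.1 • p.2) (ρ.prod σ) ν)
    (hρ : ∀ᵐ r ∂ρ, 0 < r) (hρ₀ : ρ (Set.Iic 1) ≠ 0) (hρ_top : ρ (Set.Iic 1) ≠ ∞)
    (hN : Measurable N) (hN₁ : ∀ᵐ x ∂σ, N x = 1)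
    (hNr : ∀ r : ℝ, 0 < r → ∀ x, N (r • x) = r * N x) {T : E → E} (hT : MeasurePreserving T ν ν)
    (hTN : ∀ x, N (T x) = N x) (hTr : ∀ (r : ℝ) x, T (r • x) = r • T x) :
    MeasurePreserving T σ σ := by
  refine ⟨hT.measurable, Measure.ext fun A hA => ?_⟩
  have hcone : T ⁻¹' {z | N z ≤ 1 ∧ (N z)⁻¹ • z ∈ A} =
      {z | N z ≤ 1 ∧ (N z)⁻¹ • z ∈ T ⁻¹' A} := by
    ext z
    simp only [Set.mem_preimage, Set.mem_ofPred_eq, hTN, hTr]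
  have hmeas : MeasurableSet {z | N z ≤ 1 ∧ (N z)⁻¹ • z ∈ A} :=
    (measurableSet_le hN measurable_const).inter ((hN.inv.smul measurable_id) hA)
  have h := hT.measure_preimage hmeas.nullMeasurableSet
  rw [hcone, measure_cone_of_polar hpolar hρ hN hN₁ hNr (hT.measurable hA),
    measure_cone_of_polar hpolar hρ hN hN₁ hNr hA] at h
  rw [Measure.map_apply hT.measurable hA]
  exact (ENNReal.mul_right_inj hρ₀ hρ_top).1 h

end AngularPart

section SphereSymmetry

lemma measurePreserving_circleMeasure (T : ℂ ≃ₗᵢ[ℝ] ℂ) :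
    MeasurePreserving T circleMeasure circleMeasure :=
  measurePreserving_angular_of_polar measurePreserving_circle_polar (pos_ae_radialMeasure 0)
    (radialMeasure_Iic_one_ne_zero 0) (radialMeasure_Iic_one_ne_top 0) measurable_norm
    norm_eq_one_ae_circleMeasure
    (fun r hr x => by rw [norm_smul, Real.norm_of_nonneg hr.le]) T.measurePreserving T.norm_map
    T.map_smul

/-- The Euclidean norm on `ℂ^d`; the norm instance on `Fin d → ℂ` is the sup norm. -/
def euclNorm {d : ℕ} (x : Fin d → ℂ) : ℝ := Real.sqrt (∑ i, ‖x i‖ ^ 2)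

lemma measurable_euclNorm {d : ℕ} : Measurable (euclNorm (d := d)) := by
  unfold euclNorm
  fun_prop

lemma euclNorm_smul_of_pos {d : ℕ} (r : ℝ) (hr : 0 < r) (x : Fin d → ℂ) :
    euclNorm (r • x) = r * euclNorm x := by
  simp only [euclNorm, Pi.smul_apply, norm_smul, mul_pow, ← Finset.mul_sum]
  rw [Real.sqrt_mul (by positivity), Real.sqrt_sq (norm_nonneg r), Real.norm_of_nonneg hr.le]

lemma euclNorm_vecMul {d : ℕ} {W : Matrix (Fin d) (Fin d) ℂ} (hW : W ∈ unitaryGroup (Fin d) ℂ)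
    (x : Fin d → ℂ) : euclNorm (x ᵥ* W) = euclNorm x := by
  have h : ((∑ i, ‖(x ᵥ* W) i‖ ^ 2 : ℝ) : ℂ) = ((∑ i, ‖x i‖ ^ 2 : ℝ) : ℂ) := by
    rw [ofReal_sum_norm_sq, ofReal_sum_norm_sq, star_vecMul, dotProduct_mulVec, vecMul_vecMul,
      ← star_eq_conjTranspose, mem_unitaryGroup_iff.1 hW, vecMul_one]
  rw [euclNorm, euclNorm, Complex.ofReal_inj.1 h]

lemma euclNorm_eq_one_ae (d : ℕ) : ∀ᵐ x ∂sphereMeasure d, euclNorm x = 1 := by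
  have hmeas (d : ℕ) : MeasurableSet {x : Fin d → ℂ | euclNorm x = 1} :=
    measurableSet_eq_fun measurable_euclNorm measurable_const
  induction d with
  | zero =>
    rw [sphereMeasure, ae_map_iff (by fun_prop) (hmeas 1)]
    exact norm_eq_one_ae_circleMeasure.mono fun u hu => by simp [euclNorm, hu]
  | succ d ih =>
    rw [sphereMeasure, ae_map_iff (by fun_prop) (hmeas _)]
    have hx := (Measure.quasiMeasurePreserving_snd (μ := phiMeasure (d + 1))).ae
      ((Measure.quasiMeasurePreserving_fst (ν := circleMeasure)).ae ih)
    have hu := (Measure.quasiMeasurePreserving_snd (μ := phiMeasure (d + 1))).ae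
      ((Measure.quasiMeasurePreserving_snd (μ := sphereMeasure d)).ae
        norm_eq_one_ae_circleMeasure)
    filter_upwards [hx, hu] with p hx hu
    rw [euclNorm, Real.sqrt_eq_one] at hx ⊢
    simp only [Fin.sum_univ_succ (n := d + 1), Fin.cons_zero, Fin.cons_succ, Pi.smul_apply,
      norm_smul, mul_pow, ← Finset.mul_sum, hx, hu, Real.norm_eq_abs, sq_abs, mul_one,
      Real.sin_sq_add_cos_sq]

lemma measurePreserving_vecMul_volume {d : ℕ} {W : Matrix (Fin d) (Fin d) ℂ}
    (hW : W ∈ unitaryGroup (Fin d) ℂ) : MeasurePreserving (fun x : Fin d → ℂ => x ᵥ* W) := by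
  let L : (Fin d → ℂ) →ₗ[ℝ] (Fin d → ℂ) := (toLin' Wᵀ).restrictScalars ℝ
  have hL : (fun x : Fin d → ℂ => x ᵥ* W) = L := by
    ext1 x
    simp only [L, LinearMap.coe_restrictScalars, toLin'_apply, mulVec_transpose]
  have hdet : LinearMap.det L = 1 := by
    have hnorm : ‖W.det‖ = 1 := CStarRing.norm_of_mem_unitary (det_of_mem_unitary hW)
    rw [LinearMap.det_restrictScalars, LinearMap.det_toLin', det_transpose,
      Algebra.norm_complex_apply, Complex.normSq_eq_norm_sq, hnorm, one_pow]
  rw [hL]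
  refine ⟨L.continuous_of_finiteDimensional.measurable, ?_⟩
  rw [Measure.map_linearMap_addHaar_eq_smul_addHaar _ (by rw [hdet]; exact one_ne_zero), hdet]
  simp only [inv_one, abs_one, ENNReal.ofReal_one, one_smul]

lemma measurePreserving_vecMul_sphereMeasure {d : ℕ}
    {W : Matrix (Fin (d + 1)) (Fin (d + 1)) ℂ} (hW : W ∈ unitaryGroup (Fin (d + 1)) ℂ) :
    MeasurePreserving (fun x => x ᵥ* W) (sphereMeasure d) (sphereMeasure d) :=
  measurePreserving_angular_of_polar (measurePreserving_sphere_polar d) (pos_ae_radialMeasure d)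
    (radialMeasure_Iic_one_ne_zero d) (radialMeasure_Iic_one_ne_top d) measurable_euclNorm
    (euclNorm_eq_one_ae d) euclNorm_smul_of_pos (measurePreserving_vecMul_volume hW)
    (euclNorm_vecMul hW) fun r x => smul_vecMul r x W

end SphereSymmetry

section RowMeasure

lemma measurePreserving_exp_neg_I_mul :
    MeasurePreserving (fun θ : ℝ => Complex.exp (-(Complex.I * (θ : ℂ)))) angleMeasure
      circleMeasure :=
  ((measurePreserving_circleMeasure Complex.conjLIE).comp measurePreserving_exp_I_mul).congr
    (by fun_prop) <| ae_of_all _ star_exp_I_mul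

lemma measurePreserving_mul_circleMeasure {c : ℂ} (hc : ‖c‖ = 1) :
    MeasurePreserving (fun u => c * u) circleMeasure circleMeasure :=
  measurePreserving_circleMeasure (rotation ⟨c, mem_sphere_zero_iff_norm.2 hc⟩)

/-- The angles `(α, φ_j, ψ_j)` on which the last factor `H` depends. -/
abbrev RowAngles (d : ℕ) : Type := ℝ × (Fin d → ℝ) × (Fin d → ℝ)

/-- The law of the angles of the last factor `H` in `coordMeasure`. -/
def rowMeasure (d : ℕ) : Measure (RowAngles d) :=
  angleMeasure.prod ((Measure.pi fun j : Fin d => phiMeasure (d - j.val)).prod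
    (Measure.pi fun _ : Fin d => angleMeasure))

instance isProbabilityMeasure_phiMeasure_sub {d : ℕ} (j : Fin d) :
    IsProbabilityMeasure (phiMeasure (d - j.val)) := by
  obtain ⟨e, he⟩ := Nat.exists_eq_add_of_lt j.isLt
  rw [show d - j.val = e + 1 by lia]
  infer_instance

instance isProbabilityMeasure_rowMeasure (d : ℕ) : IsProbabilityMeasure (rowMeasure d) := by
  unfold rowMeasure
  infer_instance

lemma measurePreserving_rowAngles_cons (d : ℕ) :
    MeasurePreserving (fun p : ℝ × RowAngles d × ℝ =>
        ((p.2.1.1, Fin.cons p.1 p.2.1.2.1, Fin.cons p.2.2 p.2.1.2.2) : RowAngles (d + 1)))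
      ((phiMeasure (d + 1)).prod ((rowMeasure d).prod angleMeasure)) (rowMeasure (d + 1)) := by
  have hφ : MeasurePreserving (fun p : ℝ × (Fin d → ℝ) => (Fin.cons p.1 p.2 : Fin (d + 1) → ℝ))
      ((phiMeasure (d + 1)).prod (Measure.pi fun j : Fin d => phiMeasure (d - j.val)))
      (Measure.pi fun j : Fin (d + 1) => phiMeasure (d + 1 - j.val)) := by
    simpa only [Fin.val_zero, Nat.sub_zero, Fin.val_succ, Nat.add_sub_add_right] using
      measurePreserving_finCons fun j : Fin (d + 1) => phiMeasure (d + 1 - j.val)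
  have hψ := measurePreserving_finCons fun _ : Fin (d + 1) => angleMeasure
  have hregroup := (measurePreserving_prodAssoc _ _ _).symm.comp <|
    ((MeasurePreserving.id (phiMeasure (d + 1))).prod <|
      (((MeasurePreserving.id (Measure.pi fun j : Fin d => phiMeasure (d - j.val))).prod <|
        Measure.measurePreserving_swap).comp <|
        measurePreserving_prodAssoc _ (Measure.pi fun _ : Fin d => angleMeasure) angleMeasure))
  exact ((MeasurePreserving.id angleMeasure).prod ((hφ.prod hψ).comp hregroup)).comp <|
    (measurePreserving_prodLeftComm _ _ _).comp <|
      (MeasurePreserving.id (phiMeasure (d + 1))).prod <| measurePreserving_prodAssoc _ _ _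

lemma measurable_cosCoef {X : Type*} [MeasurableSpace X] {d : ℕ} {α : X → ℝ} {φ : X → Fin d → ℝ}
    (hα : Measurable α) (hφ : Measurable φ) : Measurable fun x => cosCoef (α x) (φ x) := by
  refine measurable_pi_iff.2 fun j => ?_
  unfold cosCoef
  split_ifs <;> fun_prop

lemma measurable_sinCoef {X : Type*} [MeasurableSpace X] {d : ℕ} {φ ψ : X → Fin d → ℝ}
    (hφ : Measurable φ) (hψ : Measurable ψ) : Measurable fun x => sinCoef (φ x) (ψ x) := by
  unfold sinCoef
  fun_prop

lemma measurable_sphericalVec {X : Type*} [MeasurableSpace X] {d : ℕ} {k t : X → Fin d → ℂ}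
    (hk : Measurable k) (ht : Measurable t) :
    Measurable fun x => sphericalVec d (k x) (t x) := by
  induction d with
  | zero => exact measurable_const
  | succ d ih =>
    have htail := ih (k := fun x i => k x i.succ) (t := fun x i => t x i.succ) (by fun_prop)
      (by fun_prop)
    simp only [sphericalVec]
    fun_prop

/-- Spherical coordinates on the unit sphere of `ℂ^{d+1}`, with a global phase `e^{-iα}`. -/
def sphericalCoord (d : ℕ) (p : RowAngles d) : Fin (d + 1) → ℂ :=
  Complex.exp (-(Complex.I * (p.1 : ℂ))) • sphericalVec d (cosCoef 0 p.2.1) (sinCoef p.2.1 p.2.2)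

lemma sphericalCoord_cons (d : ℕ) (α φ₀ ψ₀ : ℝ) (φ ψ : Fin d → ℝ) :
    sphericalCoord (d + 1) (α, Fin.cons φ₀ φ, Fin.cons ψ₀ ψ) =
      Fin.cons (Complex.exp (-(Complex.I * (α : ℂ))) *
          -(Complex.exp (-(Complex.I * (ψ₀ : ℂ))) * (Real.sin φ₀ : ℂ)))
        ((Real.cos φ₀ : ℂ) • sphericalCoord d (α, φ, ψ)) := by
  ext i
  cases i using Fin.cases with
  | zero => simp [sphericalCoord, sphericalVec, sinCoef_cons]
  | succ i => simp [sphericalCoord, sphericalVec, sinCoef_cons, cosCoef_cons, mul_left_comm]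

lemma measurable_sphericalCoord (d : ℕ) : Measurable (sphericalCoord d) :=
  have hphase : Measurable fun p : RowAngles d => Complex.exp (-(Complex.I * (p.1 : ℂ))) := by
    fun_prop
  hphase.smul <| measurable_sphericalVec (measurable_cosCoef measurable_const measurable_snd.fst)
    (measurable_sinCoef measurable_snd.fst measurable_snd.snd)

/-- The head of `sphericalCoord (d + 1)` is turned by the phase `c = e^{-iα}`, that of the last row
of `H` is not (`c = 1`); the law is the same, since the phase of the head is uniform. -/
lemma measurePreserving_sphericalCoord_cons {d : ℕ}
    (h : MeasurePreserving (sphericalCoord d) (rowMeasure d) (sphereMeasure d)) {c : ℝ → ℂ}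
    (hc : Measurable c) (hc₁ : ∀ α, ‖c α‖ = 1) :
    MeasurePreserving (fun p : ℝ × RowAngles d × ℝ => (Fin.cons
        (c p.2.1.1 * -(Complex.exp (-(Complex.I * (p.2.2 : ℂ))) * (Real.sin p.1 : ℂ)))
        ((Real.cos p.1 : ℂ) • sphericalCoord d p.2.1) : Fin (d + 2) → ℂ))
      ((phiMeasure (d + 1)).prod ((rowMeasure d).prod angleMeasure)) (sphereMeasure (d + 1)) := by
  have hphase (α : ℝ) : MeasurePreserving
      (fun θ : ℝ => -c α * Complex.exp (-(Complex.I * (θ : ℂ)))) angleMeasure circleMeasure :=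
    (measurePreserving_mul_circleMeasure (by rw [norm_neg, hc₁])).comp
      measurePreserving_exp_neg_I_mul
  have hpair : MeasurePreserving (fun p : RowAngles d × ℝ =>
      (sphericalCoord d p.1, -c p.1.1 * Complex.exp (-(Complex.I * (p.2 : ℂ)))))
      ((rowMeasure d).prod angleMeasure) ((sphereMeasure d).prod circleMeasure) :=
    h.skew_product (by fun_prop) <| ae_of_all _ fun p => (hphase p.1).map_eq
  have hcomp := (measurePreserving_cons_sphereMeasure_succ d).comp
    ((MeasurePreserving.id (phiMeasure (d + 1))).prod hpair)
  refine hcomp.congr ?_ <| ae_of_all _ fun p => ?_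
  · have := measurable_sphericalCoord d
    fun_prop
  · simp only [Function.comp_apply, Prod.map, id, Complex.real_smul]
    congr 1
    ring

lemma measurePreserving_sphericalCoord (d : ℕ) :
    MeasurePreserving (sphericalCoord d) (rowMeasure d) (sphereMeasure d) := by
  induction d with
  | zero =>
    exact ((measurePreserving_const_sphereMeasure_zero.comp measurePreserving_exp_neg_I_mul).comp
      measurePreserving_fst).congr (measurable_sphericalCoord 0) <|
        ae_of_all _ fun p => funext fun i => by simp [sphericalCoord, sphericalVec]
  | succ d ih =>
    refine measurePreserving_of_comp (measurePreserving_rowAngles_cons d)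
      (measurable_sphericalCoord (d + 1)) ?_
    refine (measurePreserving_sphericalCoord_cons ih (by fun_prop)
      norm_exp_neg_I_mul).congr
      ((measurable_sphericalCoord (d + 1)).comp (by fun_prop)) <| ae_of_all _ fun p => ?_
    exact (sphericalCoord_cons d p.2.1.1 p.1 p.2.2 p.2.1.2.1 p.2.1.2.2).symm

theorem measurePreserving_prodH_last (d : ℕ) :
    MeasurePreserving (fun p : RowAngles (d + 1) => prodH p.1 p.2.1 p.2.2 (Fin.last (d + 1)))
      (rowMeasure (d + 1)) (sphereMeasure (d + 1)) := by
  have hmeas : Measurable fun p : RowAngles (d + 1) =>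
      prodH p.1 p.2.1 p.2.2 (Fin.last (d + 1)) := by
    simp only [prodH_last]
    exact measurable_sphericalVec (measurable_cosCoef measurable_fst measurable_snd.fst)
      (measurable_sinCoef measurable_snd.fst measurable_snd.snd)
  refine measurePreserving_of_comp (measurePreserving_rowAngles_cons d) hmeas ?_
  refine (measurePreserving_sphericalCoord_cons (measurePreserving_sphericalCoord d)
    measurable_const fun _ => norm_one).congr (hmeas.comp (by fun_prop)) <| ae_of_all _ fun p => ?_
  simp only [Function.comp_apply]
  rw [prodH_last_eq_cons, one_mul, sphericalCoord, smul_smul,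
    mul_comm (Real.cos p.1 : ℂ)]

end RowMeasure

section Topology

instance compactSpace_unitaryGroup (n : ℕ) : CompactSpace (unitaryGroup (Fin n) ℂ) := by
  have hbox : IsCompact (Set.univ.pi fun _ : Fin n => Set.univ.pi fun _ : Fin n =>
      Metric.closedBall (0 : ℂ) 1) :=
    isCompact_univ_pi fun _ => isCompact_univ_pi fun _ => isCompact_closedBall _ _
  refine isCompact_iff_compactSpace.1 (hbox.of_isClosed_subset
    (isClosed_unitary (R := Matrix (Fin n) (Fin n) ℂ)) fun U hU i _ j _ => ?_)
  exact mem_closedBall_zero_iff.2 (entry_norm_bound_of_unitary hU i j)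

instance polishSpace_unitaryGroup (n : ℕ) : PolishSpace (unitaryGroup (Fin n) ℂ) :=
  have : PolishSpace (Matrix (Fin n) (Fin n) ℂ) :=
    inferInstanceAs (PolishSpace (Fin n → Fin n → ℂ))
  (isClosed_unitary (R := Matrix (Fin n) (Fin n) ℂ)).polishSpace

lemma exists_isHaarMeasure_isProbabilityMeasure (G : Type*) [Group G] [TopologicalSpace G]
    [IsTopologicalGroup G] [CompactSpace G] [MeasurableSpace G] [BorelSpace G] :
    ∃ μ : Measure G, μ.IsHaarMeasure ∧ IsProbabilityMeasure μ :=
  ⟨Measure.haarMeasure ⊤, inferInstance, ⟨Measure.haarMeasure_self⟩⟩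

lemma measurePreserving_mul_right_of_isProbabilityMeasure {G : Type*} [Group G]
    [TopologicalSpace G] [IsTopologicalGroup G] [LocallyCompactSpace G] [MeasurableSpace G]
    [BorelSpace G] (μ : Measure G) [μ.IsHaarMeasure] [IsProbabilityMeasure μ] (g : G) :
    MeasurePreserving (· * g) μ μ :=
  have : IsProbabilityMeasure (μ.map (· * g)) :=
    Measure.isProbabilityMeasure_map (measurable_mul_const g).aemeasurable
  ⟨measurable_mul_const g, Measure.isHaarMeasure_eq_of_isProbabilityMeasure _ _⟩

lemma continuous_diagOne {m : ℕ} : Continuous (diagOne (m := m)) :=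
  (continuous_id.matrix_fromBlocks continuous_const continuous_const
    continuous_const).matrix_reindex _ _

variable {X : Type*} [TopologicalSpace X]

lemma continuous_phiMat {m : ℕ} (j : Fin m) {α : X → ℝ} {φ ψ : X → Fin m → ℝ} (hα : Continuous α)
    (hφ : Continuous φ) (hψ : Continuous ψ) :
    Continuous fun x => phiMat (α x) (φ x) (ψ x) j := by
  refine continuous_matrix fun r s => ?_
  simp only [phiMat, Matrix.of_apply]
  split_ifs <;> fun_prop

lemma continuous_prodH {m : ℕ} {α : X → ℝ} {φ ψ : X → Fin m → ℝ} (hα : Continuous α)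
    (hφ : Continuous φ) (hψ : Continuous ψ) : Continuous fun x => prodH (α x) (φ x) (ψ x) := by
  simp only [prodH, List.ofFn_eq_map]
  exact continuous_list_prod _ fun j _ => continuous_phiMat j hα hφ hψ

lemma continuous_V (n : ℕ) {α : X → Fin n → ℝ} {φ ψ : X → PairAngles n} (hα : Continuous α)
    (hφ : Continuous φ) (hψ : Continuous ψ) : Continuous fun x => V n (α x) (φ x) (ψ x) := by
  induction n with
  | zero => exact continuous_const
  | succ n ih =>
    cases n with
    | zero =>
      refine continuous_matrix fun r s => ?_
      simp only [V, Matrix.of_apply]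
      fun_prop
    | succ m =>
      simp only [V]
      refine (continuous_diagOne.comp (ih ?_ ?_ ?_)).matrix_mul (continuous_prodH ?_ ?_ ?_) <;>
        fun_prop

end Topology

section LastRow

variable {m : ℕ}

/-- The last row of a unitary matrix. -/
def lastRow (W : unitaryGroup (Fin (m + 1)) ℂ) : Fin (m + 1) → ℂ := W.1 (Fin.last m)

lemma continuous_lastRow : Continuous (lastRow (m := m)) :=
  (continuous_apply (A := fun _ : Fin (m + 1) => Fin (m + 1) → ℂ) (Fin.last m)).comp
    continuous_subtype_val

lemma lastRow_mul (U W : unitaryGroup (Fin (m + 1)) ℂ) : lastRow (U * W) = lastRow U ᵥ* W.1 := rfl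

/-- The embedding `A ↦ diag(A, 1)` of unitary groups. -/
def diagOneU : unitaryGroup (Fin m) ℂ →* unitaryGroup (Fin (m + 1)) ℂ :=
  MonoidHom.mk' (fun A => ⟨diagOne A.1, diagOne_mem_unitaryGroup.2 A.2⟩)
    fun A B => Subtype.ext (diagOne_mul A.1 B.1)

lemma measurable_diagOneU : Measurable (diagOneU (m := m)) :=
  ((continuous_diagOne.comp continuous_subtype_val).subtype_mk _).measurable

lemma exists_eq_diagOneU_mul {U W : unitaryGroup (Fin (m + 1)) ℂ} (h : lastRow U = lastRow W) :
    ∃ A : unitaryGroup (Fin m) ℂ, W = diagOneU A * U := by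
  obtain ⟨A, hA, hW⟩ := exists_eq_diagOne_mul W.2 U.2 h
  exact ⟨⟨A, hA⟩, Subtype.ext hW⟩

lemma exists_measurable_comp_eq_of_factorsThrough {X Y Z : Type*} [TopologicalSpace X]
    [CompactSpace X] [PolishSpace X] [MeasurableSpace X] [BorelSpace X] [TopologicalSpace Y]
    [T2Space Y] [SecondCountableTopology Y] [MeasurableSpace Y] [BorelSpace Y]
    [MeasurableSpace Z] [Nonempty Z] {r : X → Y} (hr : Continuous r) {F : X → Z}
    (hF : Measurable F) (h : F.FactorsThrough r) : ∃ Φ : Y → Z, Measurable Φ ∧ F = Φ ∘ r := by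
  obtain ⟨Φ₀, hΦ₀⟩ : ∃ Φ₀ : Y → Z, F = Φ₀ ∘ r := (Function.factorsThrough_iff F).1 h
  have hrange : MeasurableSet (Set.range r) := (isCompact_range hr).isClosed.measurableSet
  have hrestrict : Measurable ((Set.range r).domRestrict Φ₀) :=
    hr.measurable.measurable_comp_iff_restrict.1 (hΦ₀ ▸ hF)
  obtain ⟨Φ, hΦ, heq⟩ := (MeasurableEmbedding.subtype_coe hrange).exists_measurable_extend
    hrestrict fun _ => inferInstance
  refine ⟨Φ, hΦ, funext fun x => ?_⟩
  rw [hΦ₀]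
  exact (congrFun heq ⟨r x, x, rfl⟩).symm

variable {lam : Measure (unitaryGroup (Fin m) ℂ)} [lam.IsHaarMeasure] [IsProbabilityMeasure lam]
  {f : unitaryGroup (Fin (m + 1)) ℂ → ℝ≥0∞}

lemma lintegral_diagOneU_mul_eq_of_lastRow_eq (hf : Measurable f)
    {U W : unitaryGroup (Fin (m + 1)) ℂ} (h : lastRow U = lastRow W) :
    ∫⁻ g, f (diagOneU g * U) ∂lam = ∫⁻ g, f (diagOneU g * W) ∂lam := by
  obtain ⟨A, rfl⟩ := exists_eq_diagOneU_mul h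
  have := measurable_diagOneU (m := m)
  rw [← (measurePreserving_mul_right_of_isProbabilityMeasure lam A).lintegral_comp (by fun_prop)]
  simp only [map_mul, mul_assoc]

variable {Θ : Type*} [MeasurableSpace Θ] {P : Measure Θ}
  {H : Θ → unitaryGroup (Fin (m + 1)) ℂ}

/-- The average over `lam` only depends on the last row, so right translation of `H` merely moves
that row by a unitary matrix, under which `sphereMeasure` is invariant. -/
lemma lintegral_lintegral_diagOneU_mul_mul (hf : Measurable f)
    (hrow : MeasurePreserving (fun p => lastRow (H p)) P (sphereMeasure m))
    (W : unitaryGroup (Fin (m + 1)) ℂ) :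
    ∫⁻ p, ∫⁻ g, f (diagOneU g * (H p * W)) ∂lam ∂P =
      ∫⁻ p, ∫⁻ g, f (diagOneU g * H p) ∂lam ∂P := by
  have := measurable_diagOneU (m := m)
  have hF : Measurable fun U => ∫⁻ g, f (diagOneU g * U) ∂lam := by fun_prop
  obtain ⟨Φ, hΦ, heq⟩ := exists_measurable_comp_eq_of_factorsThrough continuous_lastRow hF
    fun _ _ h => lintegral_diagOneU_mul_eq_of_lastRow_eq hf h
  have hval (U) : ∫⁻ g, f (diagOneU g * U) ∂lam = Φ (lastRow U) := congrFun heq U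
  simp only [hval, lastRow_mul]
  exact (((measurePreserving_vecMul_sphereMeasure W.2).comp hrow).lintegral_comp hΦ).trans
    (hrow.lintegral_comp hΦ).symm

/-- Averaging over right translations replaces `diag(g, 1) H` by a Haar distributed matrix. -/
theorem measurePreserving_diagOneU_mul [IsProbabilityMeasure P] (hH : Measurable H)
    (hrow : MeasurePreserving (fun p => lastRow (H p)) P (sphereMeasure m))
    (lam : Measure (unitaryGroup (Fin m) ℂ)) [lam.IsHaarMeasure] [IsProbabilityMeasure lam]
    (μ : Measure (unitaryGroup (Fin (m + 1)) ℂ)) [μ.IsHaarMeasure] [IsProbabilityMeasure μ] :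
    MeasurePreserving (fun q : unitaryGroup (Fin m) ℂ × Θ => diagOneU q.1 * H q.2)
      (lam.prod P) μ := by
  have := measurable_diagOneU (m := m)
  have hmeas : Measurable fun q : unitaryGroup (Fin m) ℂ × Θ => diagOneU q.1 * H q.2 := by
    fun_prop
  refine ⟨hmeas, Measure.ext_of_lintegral _ fun f hf => ?_⟩
  calc ∫⁻ W, f W ∂((lam.prod P).map fun q => diagOneU q.1 * H q.2)
      = ∫⁻ p, ∫⁻ g, f (diagOneU g * H p) ∂lam ∂P := by
        rw [lintegral_map hf hmeas, lintegral_prod_symm _ (by fun_prop)]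
    _ = ∫⁻ W, ∫⁻ p, ∫⁻ g, f (diagOneU g * (H p * W)) ∂lam ∂P ∂μ := by
        simp only [lintegral_lintegral_diagOneU_mul_mul hf hrow, lintegral_const,
          measure_univ, mul_one]
    _ = ∫⁻ p, ∫⁻ g, ∫⁻ W, f (diagOneU g * H p * W) ∂μ ∂lam ∂P := by
        simp only [← mul_assoc]
        rw [lintegral_lintegral_swap (by fun_prop)]
        exact lintegral_congr fun p => lintegral_lintegral_swap (by fun_prop)
    _ = ∫⁻ W, f W ∂μ := by
        simp only [lintegral_mul_left_eq_self, lintegral_const, measure_univ, mul_one]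

end LastRow

section Haar

lemma measurePreserving_comp_succAbove {n : ℕ} {X : Fin (n + 1) → Type*}
    [∀ i, MeasurableSpace (X i)] (μ : ∀ i, Measure (X i)) [∀ i, SigmaFinite (μ i)]
    (k : Fin (n + 1)) {f : Fin n → Fin (n + 1)} (hf : k.succAbove = f) :
    MeasurePreserving (fun x : ∀ i, X i => ((fun i => x (f i)), x k))
      (Measure.pi μ) ((Measure.pi fun i => μ (f i)).prod (μ k)) := by
  subst hf
  exact Measure.measurePreserving_swap.comp (measurePreserving_piFinSuccAbove μ k)

lemma measurePreserving_init_last {n : ℕ} {X : Fin (n + 1) → Type*}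
    [∀ i, MeasurableSpace (X i)] (μ : ∀ i, Measure (X i)) [∀ i, SigmaFinite (μ i)] :
    MeasurePreserving (fun x : ∀ i, X i => ((fun i : Fin n => x i.castSucc), x (Fin.last n)))
      (Measure.pi μ) ((Measure.pi fun i : Fin n => μ i.castSucc).prod (μ (Fin.last n))) :=
  measurePreserving_comp_succAbove μ (Fin.last n) Fin.succAbove_last

/-- The angles of `V_n` and those of `H_{n+1}` among the angles of `V_{n+1}`. -/
def splitAngles (n : ℕ) (θ : (Fin (n + 1) → ℝ) × PairAngles (n + 1) × PairAngles (n + 1)) :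
    ((Fin n → ℝ) × PairAngles n × PairAngles n) × RowAngles n :=
  ((fun k => θ.1 k.castSucc, fun k => θ.2.1 k.castSucc, fun k => θ.2.2 k.castSucc),
    (θ.1 (Fin.last n), θ.2.1 (Fin.last n), θ.2.2 (Fin.last n)))

lemma measurePreserving_splitAngles (n : ℕ) :
    MeasurePreserving (splitAngles n) (coordMeasure (n + 1))
      ((coordMeasure n).prod (rowMeasure n)) := by
  have hα := measurePreserving_init_last fun _ : Fin (n + 1) => angleMeasure
  have hφ := measurePreserving_init_last fun k : Fin (n + 1) =>
    Measure.pi fun j : Fin k => phiMeasure (k.val - j.val)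
  have hψ := measurePreserving_init_last fun k : Fin (n + 1) =>
    Measure.pi fun _ : Fin k => angleMeasure
  exact (measurePreserving_prodProdProdComm _ _ _ _).comp <|
    hα.prod <| (measurePreserving_prodProdProdComm _ _ _ _).comp <| hφ.prod hψ

instance isProbabilityMeasure_coordMeasure (n : ℕ) : IsProbabilityMeasure (coordMeasure n) := by
  unfold coordMeasure
  infer_instance

/-- The parametrisation as a map to the unitary group. -/
def unitaryV (n : ℕ) (θ : (Fin n → ℝ) × PairAngles n × PairAngles n) : unitaryGroup (Fin n) ℂ :=
  ⟨V n θ.1 θ.2.1 θ.2.2, V_mem_unitaryGroup n θ.1 θ.2.1 θ.2.2⟩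

lemma measurable_unitaryV (n : ℕ) : Measurable (unitaryV n) :=
  ((continuous_V n continuous_fst continuous_snd.fst continuous_snd.snd).subtype_mk _).measurable

/-- The last factor `H` as an element of the unitary group. -/
def unitaryH (n : ℕ) (p : RowAngles n) : unitaryGroup (Fin (n + 1)) ℂ :=
  ⟨prodH p.1 p.2.1 p.2.2, prodH_mem_unitaryGroup p.1 p.2.1 p.2.2⟩

lemma measurable_unitaryH (n : ℕ) : Measurable (unitaryH n) :=
  ((continuous_prodH continuous_fst continuous_snd.fst continuous_snd.snd).subtype_mk _).measurable

lemma measurePreserving_lastRow_unitaryV_one :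
    MeasurePreserving (fun θ => lastRow (unitaryV 1 θ)) (coordMeasure 1) (sphereMeasure 0) :=
  measurePreserving_const_sphereMeasure_zero.comp <| measurePreserving_exp_I_mul.comp <|
    (measurePreserving_eval (fun _ : Fin 1 => angleMeasure) 0).comp measurePreserving_fst

theorem measurePreserving_unitaryV (n : ℕ) (μ : Measure (unitaryGroup (Fin (n + 1)) ℂ))
    [μ.IsHaarMeasure] [IsProbabilityMeasure μ] :
    MeasurePreserving (unitaryV (n + 1)) (coordMeasure (n + 1)) μ := by
  induction n with
  | zero =>
    obtain ⟨lam, _, _⟩ := exists_isHaarMeasure_isProbabilityMeasure (unitaryGroup (Fin 0) ℂ)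
    have hstep := measurePreserving_diagOneU_mul (measurable_unitaryV 1)
      measurePreserving_lastRow_unitaryV_one lam μ
    refine measurePreserving_of_comp measurePreserving_snd (measurable_unitaryV 1) <|
      hstep.congr ((measurable_unitaryV 1).comp measurable_snd) <| ae_of_all _ fun q => ?_
    have hone : diagOneU q.1 = 1 := by rw [Subsingleton.elim q.1 1, map_one]
    simp only [hone, one_mul, Function.comp_apply]
  | succ n ih =>
    obtain ⟨lam, _, _⟩ :=
      exists_isHaarMeasure_isProbabilityMeasure (unitaryGroup (Fin (n + 1)) ℂ)
    have hstep := measurePreserving_diagOneU_mul (measurable_unitaryH (n + 1))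
      (measurePreserving_prodH_last n) lam μ
    have hcomp := (hstep.comp ((ih lam).prod (MeasurePreserving.id (rowMeasure (n + 1))))).comp
      (measurePreserving_splitAngles (n + 1))
    exact hcomp.congr (measurable_unitaryV (n + 2)) <| ae_of_all _ fun θ => Subtype.ext rfl

theorem isHaarMeasure_isProbabilityMeasure_iff_eq_map_unitaryV {n : ℕ} (hn : 0 < n)
    (μ : Measure (unitaryGroup (Fin n) ℂ)) :
    (μ.IsHaarMeasure ∧ IsProbabilityMeasure μ) ↔ μ = (coordMeasure n).map (unitaryV n) := by
  obtain ⟨n, rfl⟩ := Nat.exists_eq_add_of_le' hn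
  refine ⟨fun ⟨_, _⟩ => (measurePreserving_unitaryV n μ).map_eq.symm, ?_⟩
  rintro rfl
  obtain ⟨μ, hμ, hμ'⟩ :=
    exists_isHaarMeasure_isProbabilityMeasure (unitaryGroup (Fin (n + 1)) ℂ)
  rw [(measurePreserving_unitaryV n μ).map_eq]
  exact ⟨hμ, hμ'⟩

end Haar

end HurwitzU

end

open HurwitzU in
theorem propositionB_general (n : ℕ) (hn : 0 < n) :
    (∀ (α : Fin n → ℝ) (φ ψ : PairAngles n), V n α φ ψ ∈ unitaryGroup (Fin n) ℂ) ∧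
      (∀ W ∈ unitaryGroup (Fin n) ℂ, ∃ (α : Fin n → ℝ) (φ ψ : PairAngles n),
        InRange α φ ψ ∧ V n α φ ψ = W) ∧
      (∀ (α α' : Fin n → ℝ) (φ ψ φ' ψ' : PairAngles n), InRange α φ ψ → InRange α' φ' ψ' →
        (∀ k j, φ k j ∈ Set.Ioo 0 (Real.pi / 2)) → V n α φ ψ = V n α' φ' ψ' →
        α = α' ∧ φ = φ' ∧ ψ = ψ') ∧
      (∀ (α : Fin n → ℝ) (φ ψ : PairAngles n) (L U : Matrix (Fin n) (Fin n) ℂ),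
        IsLU (V n α φ ψ) L U →
          (∀ l : Fin n, U l l = uDiag α φ l) ∧
          (∀ (l : ℕ) (_ : 1 ≤ l) (hl : l < n),
            ((∀ k j, 0 ≤ Real.cos (φ k j)) → 0 < radius φ l) ∧
            ∏ i : Fin l, U (Fin.castLE hl.le i) (Fin.castLE hl.le i) =
              (radius φ l : ℂ) * Complex.exp (Complex.I * (phaseArg hn α l : ℂ)))) ∧
      (∀ (α : Fin n → ℝ) (φ ψ : PairAngles n),
        (∀ (l : ℕ) (_ : 1 ≤ l) (hl : l < n),
          ((∀ k j, 0 ≤ Real.cos (φ k j)) → 0 ≤ radius φ l) ∧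
          (leading (V n α φ ψ) l hl.le).det =
            (radius φ l : ℂ) * Complex.exp (Complex.I * (phaseArg hn α l : ℂ))) ∧
        (V n α φ ψ).det = Complex.exp (Complex.I * (α ⟨0, hn⟩ : ℂ))) ∧
      ∀ μ : Measure (unitaryGroup (Fin n) ℂ),
        (μ.IsHaarMeasure ∧ IsProbabilityMeasure μ) ↔ μ = (coordMeasure n).map (unitaryV n) :=
  ⟨V_mem_unitaryGroup n, fun _ hW => exists_V_eq n hW,
    fun _ _ _ _ _ _ h h' hφ heq => eq_of_V_eq n h h' hφ heq,
    fun _ _ _ _ _ hLU => ⟨hLU.diag_eq hn, fun l hl1 hl =>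
      ⟨fun hcos => hLU.radius_pos hn hcos l hl1 hl.le, hLU.prod_diag hn l hl1 hl.le⟩⟩,
    fun α φ ψ => ⟨fun l hl1 hl =>
      ⟨fun hcos => radius_nonneg hcos l, det_leading_V hn α φ ψ l hl1 hl.le⟩, det_V n hn α φ ψ⟩,
    isHaarMeasure_isProbabilityMeasure_iff_eq_map_unitaryV hn⟩

theorem propositionB (n : ℕ) (hn : 0 < n) :
    -- every parameter value gives a unitary matrix
    ∃ hV : ∀ (α : Fin n → ℝ) (φ ψ : HurwitzU.PairAngles n),
        HurwitzU.V n α φ ψ ∈ Matrix.unitaryGroup (Fin n) ℂ,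
      -- every unitary matrix is obtained from angles in the stated ranges
      (∀ W ∈ Matrix.unitaryGroup (Fin n) ℂ,
        ∃ (α : Fin n → ℝ) (φ ψ : HurwitzU.PairAngles n),
          HurwitzU.InRange α φ ψ ∧ HurwitzU.V n α φ ψ = W) ∧
      -- the angles are unique when all `φ` are in the open interval
      (∀ (α α' : Fin n → ℝ) (φ ψ φ' ψ' : HurwitzU.PairAngles n),
        HurwitzU.InRange α φ ψ → HurwitzU.InRange α' φ' ψ' →
        (∀ k j, φ k j ∈ Set.Ioo 0 (Real.pi / 2)) → (∀ k j, φ' k j ∈ Set.Ioo 0 (Real.pi / 2)) →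
        HurwitzU.V n α φ ψ = HurwitzU.V n α' φ' ψ' → α = α' ∧ φ = φ' ∧ ψ = ψ') ∧
      -- diagonal of the factor `U`, radii and phases of its partial products
      (∀ (α : Fin n → ℝ) (φ ψ : HurwitzU.PairAngles n), HurwitzU.InRange α φ ψ →
        ∀ L U : Matrix (Fin n) (Fin n) ℂ, HurwitzU.IsLU (HurwitzU.V n α φ ψ) L U →
          (∀ l : Fin n, U l l = HurwitzU.uDiag α φ l) ∧
          (∀ (l : ℕ) (_ : 1 ≤ l) (hl : l < n),
            0 < HurwitzU.radius φ l ∧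
            ∏ i : Fin l, U (Fin.castLE hl.le i) (Fin.castLE hl.le i) =
              (HurwitzU.radius φ l : ℂ) *
                Complex.exp (Complex.I * (HurwitzU.phaseArg hn α l : ℂ)))) ∧
      -- radii and phases of the principal minors, and the determinant
      (∀ (α : Fin n → ℝ) (φ ψ : HurwitzU.PairAngles n), HurwitzU.InRange α φ ψ →
        (∀ (l : ℕ) (_ : 1 ≤ l) (hl : l < n),
          0 ≤ HurwitzU.radius φ l ∧
          (HurwitzU.leading (HurwitzU.V n α φ ψ) l hl.le).det =
            (HurwitzU.radius φ l : ℂ) *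
              Complex.exp (Complex.I * (HurwitzU.phaseArg hn α l : ℂ))) ∧
        (HurwitzU.V n α φ ψ).det = Complex.exp (Complex.I * (α ⟨0, hn⟩ : ℂ))) ∧
      -- the normalised Haar measure in these coordinates
      (∀ μ : MeasureTheory.Measure (Matrix.unitaryGroup (Fin n) ℂ),
        (μ.IsHaarMeasure ∧ MeasureTheory.IsProbabilityMeasure μ) ↔
          μ = MeasureTheory.Measure.map
            (fun θ : (Fin n → ℝ) × HurwitzU.PairAngles n × HurwitzU.PairAngles n =>
              (⟨HurwitzU.V n θ.1 θ.2.1 θ.2.2, hV θ.1 θ.2.1 θ.2.2⟩ :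
                Matrix.unitaryGroup (Fin n) ℂ))
            (HurwitzU.coordMeasure n)) := by
  obtain ⟨hV, hsurj, hinj, hLU, hminor, hHaar⟩ := propositionB_general n hn
  refine ⟨hV, hsurj, fun α α' φ ψ φ' ψ' h h' hφ _ => hinj α α' φ ψ φ' ψ' h h' hφ,
    fun α φ ψ h L U hVLU => ?_, fun α φ ψ h => ?_, hHaar⟩
  · obtain ⟨hdiag, hprod⟩ := hLU α φ ψ L U hVLU
    exact ⟨hdiag, fun l hl1 hl => (hprod l hl1 hl).imp_left fun hpos => hpos h.cos_nonneg⟩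
  · obtain ⟨hlead, hdet⟩ := hminor α φ ψ
    exact ⟨fun l hl1 hl => (hlead l hl1 hl).imp_left fun hpos => hpos h.cos_nonneg, hdet⟩
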